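/- **Setting.** Let $p,n\ge 1$ be integers and let $\mathbf P$ be the law of a pair $(\mathbf X,Y)\in\mathbb R^p\times\mathbb R$ with $\mathbb E Y^2<\infty$ and $Y=f^\star(\theta^{\star T}\mathbf X)+W$, $\mathbb E[W\mid\mathbf X]=0$, where $f^\star:\mathbb R\to\mathbb R$ is measurable and $\theta^\star\in\mathcal S^p_{1,+}$. Here $\mathcal S^p_{1,+}$ is the set of $\theta\in\mathbb R^p$ with $\|\theta\|_1=1$ whose first nonzero coordinate is positive. For $I\subset\{1,\dots,p\}$ let $\mathcal S^p_{1,+}(I)=\{\theta\in\mathcal S^p_{1,+}:\theta_j=0\iff j\notin I\}$. Let $L,\sigma,\ell>0$ and $C\ge1$ be constants. Assume: * (N) for all integers $k\ge2$, $\mathbb E[|W|^k\mid\mathbf X]\le\frac{k!}{2}\sigma^2L^{k-2}$ almost surely; * (B) $\|\mathbf X\|_\infty\le1$ almost surely, and $|f^\star|\le C$ on $[-1,1]$. Let $\varphi_1,\varphi_2,\dots:[-1,1]\to[-1,1]$ be differentiable with $\|\varphi_j'\|_\infty\le\ell j$. For $M\ge1$ and $\Lambda>0$ put $$\mathcal B_M(\Lambda)=\Big\{\beta\in\mathbb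 R^M:\sum_{j=1}^Mj|\beta_j|\le\Lambda,\ \beta_M\ne0\Big\},\qquad \Phi_M(\beta)=\sum_{j=1}^M\beta_j\varphi_j,\qquad \mathcal F_M(\Lambda)=\Phi_M(\mathcal B_M(\Lambda)).$$ Let the sample $\mathcal D_n=\{(\mathbf X_1,Y_1),\dots,(\mathbf X_n,Y_n)\}$ have law $\mathbf P^{\otimes n}$, and put $$R(\theta,f)=\mathbb E\big[(Y-f(\theta^T\mathbf X))^2\big],\qquad R_n(\theta,f)=\frac1n\sum_{i=1}^n(Y_i-f(\theta^T\mathbf X_i))^2.$$ **Prior and posterior.** Let $\mu_I$ be the uniform probability measure (normalized $(|I|-1)$-dimensional surface measure) on $\mathcal S^p_{1,+}(I)$, $I\ne\emptyset$, and let $\nu_M$ be the image under $\Phi_M$ of the uniform probability measure on $\mathcal B_M(C+1)$. Let $\pi=\mu\otimes\nu$, where $$\mu=\frac{\sum_{i=1}^p10^{-i}\sum_{|I|=i}\binom pi^{-1}\mu_I}{\sum_{i=1}^p10^{-i}},\qquad \nu=\frac{\sum_{M=1}^n10^{-M}\nu_M}{\sum_{M=1}^n10^{-M}}.$$ For $\lambda>0$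 the Gibbs posterior $\hat\rho_\lambda$ is the data-dependent probability measure with $$\frac{d\hat\rho_\lambda}{d\pi}(\theta,f)=\frac{e^{-\lambda R_n(\theta,f)}}{\int e^{-\lambda R_n}\,d\pi}.$$ **Theorem.** There is a constant $\Xi>0$ depending only on $L,C,\sigma,\ell$ such that the following holds in every such setting. Put $w=8(2C+1)\max[L,2C+1]$ and $$\lambda=\frac{n}{w+2[(2C+1)^2+4\sigma^2]},$$ and let $(\hat\theta_\lambda,\hat f_\lambda)$ be drawn from $\hat\rho_\lambda$ conditionally on the data. Then, for every $\delta\in(0,1)$, with probability at least $1-\delta$ (with respect to $\mathbf P^{\otimes n}$ and the conditional law $\hat\rho_\lambda$ jointly), $$R(\hat\theta_\lambda,\hat f_\lambda)-R(\theta^\star,f^\star)\le\Xi\inf_{\substack{\emptyset\ne I\subset\{1,\dots,p\}\\1\le M\le n}}\Big\{R^\star_{I,M}-R(\theta^\star,f^\star)+\frac{M\log(Cn)+|I|\log(pn)+\log(2/\delta)}{n}\Big\},$$ where $R^\star_{I,M}=\inf\{R(\theta,f):\theta\in\mathcal S^p_{1,+}(I),\ f\in\mathcal F_M(C)\}$.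 If a minimizer $(\theta^\star_{I,M},f^\star_{I,M})$ exists, then $R^\star_{I,M}=R(\theta^\star_{I,M},f^\star_{I,M})$. -/

import Mathlib

open MeasureTheory ProbabilityTheory
open scoped ENNReal

namespace SingleIndex

noncomputable section

/-! ### Observations, single-index model, assumptions -/

/-- Index vectors `θ ∈ ℝ^p`. -/
abbrev Idx (p : ℕ) : Type := EuclideanSpace ℝ (Fin p)

/-- Values of a pair `(X, Y) ∈ ℝ^p × ℝ`. The design vector lives in `Fin p → ℝ`, whose norm is the
supremum norm. -/
abbrev Obs (p : ℕ) : Type := (Fin p → ℝ) × ℝ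

/-- The scalar `θᵀ x`. -/
def dot {p : ℕ} (θ : Idx p) (x : Fin p → ℝ) : ℝ := ∑ j, θ j * x j

/-- `S^p_{1,+}`: unit `ℓ¹`-norm and positive first nonzero coordinate. -/
def sphere (p : ℕ) : Set (Idx p) :=
  {θ | ∑ j, |θ j| = 1 ∧ ∀ j, θ j ≠ 0 → (∀ i, i < j → θ i = 0) → 0 < θ j}

/-- `S^p_{1,+}(I)`: the elements of `S^p_{1,+}` whose support is exactly `I`. -/
def sphereOn {p : ℕ} (I : Finset (Fin p)) : Set (Idx p) :=
  {θ | θ ∈ sphere p ∧ ∀ j, θ j = 0 ↔ j ∉ I}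

/-- The noise `W = Y - f⋆(θ⋆ᵀ X)`, as a function of the pair `(X, Y)`. -/
def noise {p : ℕ} (θs : Idx p) (fs : ℝ → ℝ) (z : Obs p) : ℝ := z.2 - fs (dot θs z.1)

/-- The σ-field generated by `X`. -/
@[reducible] def sigmaX (p : ℕ) : MeasurableSpace (Obs p) := MeasurableSpace.comap Prod.fst inferInstance

/-- The law `P` of `(X, Y)` follows the single-index model `Y = f⋆(θ⋆ᵀ X) + W`, where
`E[Y²] < ∞`, `E[W | X] = 0`, `f⋆` is measurable and `θ⋆ ∈ S^p_{1,+}`. -/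
structure IsSingleIndexModel {p : ℕ} (P : Measure (Obs p)) (θs : Idx p) (fs : ℝ → ℝ) : Prop where
  isProbabilityMeasure : IsProbabilityMeasure P
  measurable_link : Measurable fs
  index_mem : θs ∈ sphere p
  integrable_sq : Integrable (fun z : Obs p => z.2 ^ 2) P
  noise_centered : P[noise θs fs | sigmaX p] =ᵐ[P] 0

/-- Bernstein-type conditional moment condition on the noise:
`E[|W|^k | X] ≤ (k! / 2) σ² L^(k-2)` for all integers `k ≥ 2`. The bound on the (a priori possibly
infinite) conditional moments entails that `|W|^k` is integrable, which is recorded explicitly. -/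
def AssumptionN {p : ℕ} (P : Measure (Obs p)) (θs : Idx p) (fs : ℝ → ℝ) (L σ : ℝ) : Prop :=
  ∀ k : ℕ, 2 ≤ k →
    Integrable (fun z => |noise θs fs z| ^ k) P ∧
    ∀ᵐ z ∂P, (P[fun z => |noise θs fs z| ^ k | sigmaX p]) z
      ≤ (k.factorial : ℝ) / 2 * σ ^ 2 * L ^ (k - 2)

/-- `‖X‖_∞ ≤ 1` almost surely and `|f⋆| ≤ C` on `[-1, 1]`. -/
def AssumptionB {p : ℕ} (P : Measure (Obs p)) (fs : ℝ → ℝ) (C : ℝ) : Prop :=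
  (∀ᵐ z ∂P, ‖z.1‖ ≤ 1) ∧ ∀ t ∈ Set.Icc (-1 : ℝ) 1, |fs t| ≤ C

/-! ### Dictionary and approximation spaces -/

/-- A dictionary `φ₁, φ₂, …` of differentiable functions on `[-1, 1]` with values in `[-1, 1]` and
`‖φ_j'‖_∞ ≤ ℓ j`. (The entry `toFun 0` and the values outside `[-1, 1]` are never used.) -/
structure Dictionary (ℓ : ℝ) where
  toFun : ℕ → ℝ → ℝ
  abs_le_one : ∀ j, 1 ≤ j → ∀ t ∈ Set.Icc (-1 : ℝ) 1, |toFun j t| ≤ 1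
  differentiableOn : ∀ j, 1 ≤ j → DifferentiableOn ℝ (toFun j) (Set.Icc (-1) 1)
  abs_deriv_le : ∀ j, 1 ≤ j → ∀ t ∈ Set.Icc (-1 : ℝ) 1,
    |derivWithin (toFun j) (Set.Icc (-1) 1) t| ≤ ℓ * j

/-- Continuous functions on `[-1, 1]`. This space contains the span `F` of the dictionary. -/
abbrev LinkSpace : Type := C(Set.Icc (-1 : ℝ) 1, ℝ)

/-- Borel σ-field of the uniform norm; on the finite-dimensional spaces spanned by `φ₁, …, φ_n` it
induces their canonical Borel σ-field. -/
instance instMeasurableSpaceLinkSpace : MeasurableSpace LinkSpace := borel _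

instance instBorelSpaceLinkSpace : BorelSpace LinkSpace := ⟨rfl⟩

/-- A link function defined on `[-1, 1]`, viewed as a function on `ℝ` (extended by constants). Under
`‖X‖_∞ ≤ 1` and `‖θ‖₁ = 1`, it is almost surely evaluated on `[-1, 1]` only. -/
def linkFun (f : LinkSpace) : ℝ → ℝ :=
  Set.IccExtend (show (-1 : ℝ) ≤ 1 by norm_num) f

/-- The function `φ_{i+1}` as a continuous function on `[-1, 1]`. -/
def Dictionary.atom {ℓ : ℝ} (φ : Dictionary ℓ) (i : ℕ) : LinkSpace where
  toFun := fun t => φ.toFun (i + 1) t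
  continuous_toFun :=
    (φ.differentiableOn (i + 1) (Nat.le_add_left 1 i)).continuousOn.domRestrict

/-- The map `Φ_M : (β₁, …, β_M) ↦ ∑_{j ≤ M} β_j φ_j`; the coordinate `i : Fin M` stands for
`j = i + 1`. -/
def Dictionary.comb {ℓ : ℝ} (φ : Dictionary ℓ) (M : ℕ) (β : Fin M → ℝ) : LinkSpace :=
  ∑ i : Fin M, β i • φ.atom i

/-- `B_M(Λ) = {β ∈ ℝ^M : ∑_{j ≤ M} j |β_j| ≤ Λ and β_M ≠ 0}`. -/
def coeffSet (M : ℕ) (Λ : ℝ) : Set (Fin M → ℝ) :=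
  {β | ∑ i : Fin M, ((i : ℕ) + 1 : ℝ) * |β i| ≤ Λ ∧ ∀ i : Fin M, (i : ℕ) + 1 = M → β i ≠ 0}

/-- `F_M(Λ) = Φ_M(B_M(Λ))`. -/
def Dictionary.linkSet {ℓ : ℝ} (φ : Dictionary ℓ) (M : ℕ) (Λ : ℝ) : Set LinkSpace :=
  φ.comb M '' coeffSet M Λ

/-! ### Risks -/

/-- `R(θ, f) = E[(Y - f(θᵀ X))²]`. -/
def predRisk {p : ℕ} (P : Measure (Obs p)) (θ : Idx p) (f : ℝ → ℝ) : ℝ :=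
  ∫ z, (z.2 - f (dot θ z.1)) ^ 2 ∂P

/-- `R_n(θ, f) = (1/n) ∑_i (Y_i - f(θᵀ X_i))²`. -/
def empRisk {p n : ℕ} (D : Fin n → Obs p) (θ : Idx p) (f : ℝ → ℝ) : ℝ :=
  (1 / (n : ℝ)) * ∑ i, ((D i).2 - f (dot θ (D i).1)) ^ 2

/-- The infimum of `R` over `S^p_{1,+}(I) × F_M(C)`. It is `R(θ⋆_{I,M}, f⋆_{I,M})` whenever there is
a minimizer `(θ⋆_{I,M}, f⋆_{I,M})`. -/
def bestRisk {p : ℕ} {ℓ : ℝ} (P : Measure (Obs p)) (φ : Dictionary ℓ) (C : ℝ)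
    (I : Finset (Fin p)) (M : ℕ) : ℝ :=
  sInf ((fun q : Idx p × LinkSpace => predRisk P q.1 (linkFun q.2)) '' (sphereOn I ×ˢ φ.linkSet M C))

/-! ### Prior and Gibbs posterior -/

/-- `μ_I`, the uniform probability measure on `S^p_{1,+}(I)`: the normalized `(|I| - 1)`-dimensional
surface (Hausdorff) measure. -/
def uniformIdx {p : ℕ} (I : Finset (Fin p)) : Measure (Idx p) :=
  ProbabilityTheory.cond (Measure.hausdorffMeasure ((I.card : ℝ) - 1)) (sphereOn I)

/-- The prior `μ` on indexes: the mixture of the `μ_I` (`I` nonempty) in which `μ_I` has weight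
proportional to `10^(-|I|) / (p choose |I|)`. Since there are `(p choose i)` sets of size `i`, the
total weight is `∑_{i=1}^p 10^(-i)`, by which we divide. -/
def priorIdx (p : ℕ) : Measure (Idx p) :=
  (∑ i ∈ Finset.Icc 1 p, (10 : ℝ≥0∞)⁻¹ ^ i)⁻¹ •
    ∑ i ∈ Finset.Icc 1 p, (10 : ℝ≥0∞)⁻¹ ^ i •
      ∑ I ∈ Finset.powersetCard i (Finset.univ : Finset (Fin p)),
        ((p.choose i : ℕ) : ℝ≥0∞)⁻¹ • uniformIdx I

/-- `ν_M`, the image under `Φ_M` of the uniform probability measure on `B_M(Λ)`. -/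
def Dictionary.uniformLink {ℓ : ℝ} (φ : Dictionary ℓ) (M : ℕ) (Λ : ℝ) : Measure LinkSpace :=
  (ProbabilityTheory.cond volume (coeffSet M Λ)).map (φ.comb M)

/-- The prior `ν` on link functions: the mixture of `ν_1, …, ν_n` (with `Λ = C + 1`) with weights
proportional to `10^(-M)`. -/
def Dictionary.priorLink {ℓ : ℝ} (φ : Dictionary ℓ) (n : ℕ) (C : ℝ) : Measure LinkSpace :=
  (∑ M ∈ Finset.Icc 1 n, (10 : ℝ≥0∞)⁻¹ ^ M)⁻¹ •
    ∑ M ∈ Finset.Icc 1 n, (10 : ℝ≥0∞)⁻¹ ^ M • φ.uniformLink M (C + 1)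

/-- The prior `π = μ ⊗ ν`. -/
def Dictionary.prior {ℓ : ℝ} (φ : Dictionary ℓ) (p n : ℕ) (C : ℝ) : Measure (Idx p × LinkSpace) :=
  (priorIdx p).prod (φ.priorLink n C)

/-- The Gibbs posterior `ρ̂_lam`, with density `exp(-lam R_n(θ,f)) / ∫ exp(-lam R_n) dπ` with respect
to the prior `π`. -/
def Dictionary.gibbs {ℓ : ℝ} (φ : Dictionary ℓ) {p n : ℕ} (C lam : ℝ) (D : Fin n → Obs p) :
    Measure (Idx p × LinkSpace) :=
  (φ.prior p n C).tilted (fun q => -lam * empRisk D q.1 (linkFun q.2))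

/-- The inverse temperature `n / (w + 2 [(2C+1)² + 4σ²])`, where `w = 8 (2C+1) max(L, 2C+1)`. -/
def invTemp (n : ℕ) (L C σ : ℝ) : ℝ :=
  (n : ℝ) / (8 * (2 * C + 1) * max L (2 * C + 1) + 2 * ((2 * C + 1) ^ 2 + 4 * σ ^ 2))

/-- The pairs `(I, M)` with `∅ ≠ I ⊆ {1, …, p}` and `1 ≤ M ≤ n`. -/
abbrev ModelIndex (p n : ℕ) : Type :=
  {q : Finset (Fin p) × ℕ // q.1.Nonempty ∧ 1 ≤ q.2 ∧ q.2 ≤ n}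

end

end SingleIndex

open SingleIndex

namespace SingleIndex

/-! ### Bernstein's moment generating function bound -/

/-! Write `D(q)` for the squared `L²(P)` distance between the predictor `q = (θ, f)` and the
regression function. Since the noise is centred given `X`, `D` is the excess risk. One term of the
excess loss is `T = u (2W + u)`, with `u` the bounded gap. All its absolute moments of order `k ≥ 2`
carry the factor `u²`, so its Bernstein variance is at most a constant times its mean `D`. This
self-bounding property yields the fast rate `1/n`. With `s = unitTemp L C σ`, the quadratic
Bernstein term is exactly `s D / 2`, whence `E exp(-s T) ≤ exp(-s D / 2)` and `E exp(s T) ≤ exp(3 s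
D / 2)` (`lintegral_exp_neg_excessLoss_le`, `lintegral_exp_excessLoss_le`).

Let `T_n` be the sum of the excess losses over the sample. The posterior mass of `{D > ρ}` is at
most `exp(-n s ρ / 2)` times `U = ∫ exp(n s D / 2 - s T_n) dπ`, divided by the normalizer `Z = ∫
exp(-s T_n) dπ`. Fubini and independence give `E U ≤ 1`. For any set `A` of positive prior mass,
Cauchy-Schwarz on `A` bounds `1/Z` by `V = π(A)⁻² ∫_A exp(s T_n) dπ`, and `E V` is controlled by
`sup_A D` and `π(A)`. As the posterior mass is at most one, the arithmetic-geometric inequality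
replaces the product `U V` by a sum, whose expectation is at most `δ`
(`Dictionary.gibbs_concentration`).

It remains to choose `A`: a ball of radius of order `1/n` around a near-minimizer in the model `(I,
M)`. On it `D` is at most twice its value at the centre plus `O(1/n²)`. Its prior mass is at least
`(20 p n)^(-|I|) (10 n)^(-M)`, because contracting the whole model towards the centre by the factor
`1/n` lands inside the ball and scales the uniform measure explicitly (`uniformIdx_ball_ge`,
`Dictionary.uniformLink_ball_ge`). The logarithm of this mass is the complexity term of the oracle
bound. -/

theorem hasSum_abs_pow_add_two (x : ℝ) :
    HasSum (fun k : ℕ => |x| ^ (k + 2) / ((k + 2).factorial : ℝ)) (Real.exp |x| - 1 - |x|) := by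
  have h : HasSum (fun n : ℕ => |x| ^ n / (n.factorial : ℝ)) (Real.exp |x|) := by
    rw [Real.exp_eq_exp_ℝ]
    exact NormedSpace.expSeries_div_hasSum_exp |x|
  have h2 := (hasSum_nat_add_iff' 2).2 h
  simpa [Finset.sum_range_succ, sub_sub] using h2

/-- The linear term stays signed, so the mean enters exactly, while the remainder involves only
absolute moments of order at least two. For negative `x` this is `|x| ≤ sinh |x|`. -/
theorem exp_le_add_exp_abs (x : ℝ) : Real.exp x ≤ 1 + x + (Real.exp |x| - 1 - |x|) := by
  rcases le_total 0 x with hx | hx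
  · rw [abs_of_nonneg hx]; linarith
  · rw [abs_of_nonpos hx]
    have h := Real.self_le_sinh_iff.2 (neg_nonneg.2 hx)
    rw [Real.sinh_eq, neg_neg] at h
    linarith

/-- Bernstein's inequality for the Laplace transform, under Bernstein's moment condition. -/
theorem lintegral_exp_le_of_moments {Ω : Type*} [MeasurableSpace Ω] (P : Measure Ω)
    [IsProbabilityMeasure P] {T : Ω → ℝ} (hT : Integrable T P) {v w s : ℝ}
    (hw : 0 ≤ w) (hs : 0 ≤ s) (hsw : s * w < 1)
    (hmom : ∀ k : ℕ, 2 ≤ k → Integrable (fun z => |T z| ^ k) P ∧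
      ∫ z, |T z| ^ k ∂P ≤ (k.factorial : ℝ) / 2 * v * w ^ (k - 2)) :
    ∫⁻ z, ENNReal.ofReal (Real.exp (s * T z)) ∂P
      ≤ ENNReal.ofReal (Real.exp (s * ∫ z, T z ∂P + s ^ 2 * v / (2 * (1 - s * w)))) := by
  have hsT : Integrable (fun z => s * T z) P := hT.const_mul s
  have hterm : ∀ k : ℕ, ∫⁻ z, ENNReal.ofReal (|s * T z| ^ (k + 2) / ((k + 2).factorial : ℝ)) ∂P
      ≤ ENNReal.ofReal (s ^ 2 * v / 2 * (s * w) ^ k) := by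
    intro k
    obtain ⟨hi, hb⟩ := hmom (k + 2) (by omega)
    have heq : ∀ z, |s * T z| ^ (k + 2) / ((k + 2).factorial : ℝ)
        = s ^ (k + 2) / ((k + 2).factorial : ℝ) * |T z| ^ (k + 2) := by
      intro z
      rw [abs_mul, abs_of_nonneg hs, mul_pow]; ring
    simp_rw [heq]
    rw [← ofReal_integral_eq_lintegral_ofReal (hi.const_mul _)
      (Filter.Eventually.of_forall fun z => by positivity), integral_const_mul]
    apply ENNReal.ofReal_le_ofReal
    have hf : (0 : ℝ) < ((k + 2).factorial : ℝ) := by positivity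
    calc s ^ (k + 2) / ((k + 2).factorial : ℝ) * ∫ z, |T z| ^ (k + 2) ∂P
        ≤ s ^ (k + 2) / ((k + 2).factorial : ℝ)
          * (((k + 2).factorial : ℝ) / 2 * v * w ^ (k + 2 - 2)) := by gcongr
      _ = s ^ 2 * v / 2 * (s * w) ^ k := by
          rw [Nat.add_sub_cancel, mul_pow, pow_add]; field_simp
  -- The moment of order two is nonnegative and bounded by `v`.
  have hv : 0 ≤ v := by
    have h := (integral_nonneg (fun z => by positivity)).trans (hmom 2 le_rfl).2
    norm_num at h; linarith
  have hsw0 : 0 ≤ s * w := mul_nonneg hs hw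
  set b : ℝ := s ^ 2 * v / (2 * (1 - s * w)) with hb
  have hgeom : HasSum (fun k : ℕ => s ^ 2 * v / 2 * (s * w) ^ k) b := by
    have h := (hasSum_geometric_of_lt_one hsw0 hsw).mul_left (s ^ 2 * v / 2)
    have hbe : b = s ^ 2 * v / 2 * (1 - s * w)⁻¹ := by rw [hb]; field_simp
    rw [hbe]
    exact h
  have hpsi : ∫⁻ z, ENNReal.ofReal (Real.exp |s * T z| - 1 - |s * T z|) ∂P ≤ ENNReal.ofReal b := by
    have heq : ∀ z, ENNReal.ofReal (Real.exp |s * T z| - 1 - |s * T z|)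
        = ∑' k : ℕ, ENNReal.ofReal (|s * T z| ^ (k + 2) / ((k + 2).factorial : ℝ)) := by
      intro z
      have h := hasSum_abs_pow_add_two (s * T z)
      rw [← h.tsum_eq, ENNReal.ofReal_tsum_of_nonneg (fun k => by positivity) h.summable]
    simp_rw [heq]
    rw [lintegral_tsum fun k => ?_]
    · calc _ ≤ ∑' k : ℕ, ENNReal.ofReal (s ^ 2 * v / 2 * (s * w) ^ k) :=
            ENNReal.tsum_le_tsum hterm
        _ = ENNReal.ofReal b := by
            rw [← hgeom.tsum_eq, ENNReal.ofReal_tsum_of_nonneg (fun k => by positivity)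
              hgeom.summable]
    · exact (((continuous_abs.comp_aestronglyMeasurable
        hsT.aestronglyMeasurable).aemeasurable.pow_const _).div_const _).ennreal_ofReal
  have hpsi_nonneg : ∀ z, 0 ≤ Real.exp |s * T z| - 1 - |s * T z| := fun z =>
    (hasSum_abs_pow_add_two (s * T z)).nonneg fun k => by positivity
  have hpsi_int : Integrable (fun z => Real.exp |s * T z| - 1 - |s * T z|) P := by
    refine ⟨?_, ?_⟩
    · exact (show Continuous fun x : ℝ => Real.exp |x| - 1 - |x| by
        fun_prop).comp_aestronglyMeasurable hsT.aestronglyMeasurable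
    · rw [hasFiniteIntegral_iff_ofReal (Filter.Eventually.of_forall hpsi_nonneg)]
      exact hpsi.trans_lt ENNReal.ofReal_lt_top
  have hpsi_le : ∫ z, (Real.exp |s * T z| - 1 - |s * T z|) ∂P ≤ b := by
    have h0 : 0 ≤ b := hgeom.nonneg fun k => by positivity
    rw [← ENNReal.ofReal_le_ofReal_iff h0, ofReal_integral_eq_lintegral_ofReal hpsi_int
      (Filter.Eventually.of_forall hpsi_nonneg)]
    exact hpsi
  have hone : Integrable (fun z => 1 + s * T z) P := (integrable_const 1).add hsT
  calc ∫⁻ z, ENNReal.ofReal (Real.exp (s * T z)) ∂P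
      ≤ ∫⁻ z, ENNReal.ofReal (1 + s * T z + (Real.exp |s * T z| - 1 - |s * T z|)) ∂P :=
        lintegral_mono fun z => ENNReal.ofReal_le_ofReal (exp_le_add_exp_abs _)
    _ = ENNReal.ofReal (∫ z, (1 + s * T z + (Real.exp |s * T z| - 1 - |s * T z|)) ∂P) :=
        (ofReal_integral_eq_lintegral_ofReal (hone.add hpsi_int)
          (Filter.Eventually.of_forall fun z =>
            (Real.exp_pos _).le.trans (exp_le_add_exp_abs _))).symm
    _ ≤ _ := by
        apply ENNReal.ofReal_le_ofReal
        rw [integral_add hone hpsi_int, integral_add (integrable_const 1) hsT, integral_const_mul]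
        simp only [integral_const, probReal_univ, smul_eq_mul, mul_one]
        have := Real.add_one_le_exp (s * ∫ z, T z ∂P + b)
        linarith

/-! ### Excess loss in the single-index model -/

theorem abs_dot_le {p : ℕ} (θ : Idx p) {x : Fin p → ℝ} (hx : ‖x‖ ≤ 1) :
    |dot θ x| ≤ ∑ j, |θ j| := by
  refine (Finset.abs_sum_le_sum_abs _ _).trans (Finset.sum_le_sum fun j _ => ?_)
  rw [abs_mul]
  have hj : |x j| ≤ 1 := (norm_le_pi_norm x j).trans hx
  exact mul_le_of_le_one_right (abs_nonneg _) hj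

theorem dot_sub_left {p : ℕ} (θ η : Idx p) (x : Fin p → ℝ) : dot (θ - η) x = dot θ x - dot η x := by
  simp [dot, sub_mul, Finset.sum_sub_distrib]

theorem dot_mem_Icc {p : ℕ} {θ : Idx p} (hθ : θ ∈ sphere p) {x : Fin p → ℝ} (hx : ‖x‖ ≤ 1) :
    dot θ x ∈ Set.Icc (-1 : ℝ) 1 :=
  abs_le.1 ((abs_dot_le θ hx).trans hθ.1.le)

theorem continuous_dot {p : ℕ} : Continuous fun q : Idx p × (Fin p → ℝ) => dot q.1 q.2 := by
  unfold dot; fun_prop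

theorem continuous_linkFun_dot {p : ℕ} :
    Continuous fun q : (Idx p × LinkSpace) × (Fin p → ℝ) => linkFun q.1.2 (dot q.1.1 q.2) := by
  unfold linkFun Set.IccExtend
  have h1 : Continuous fun q : (Idx p × LinkSpace) × (Fin p → ℝ) =>
      Set.projIcc (-1 : ℝ) 1 (by norm_num) (dot q.1.1 q.2) :=
    continuous_projIcc.comp (continuous_dot.comp (by fun_prop :
      Continuous fun q : (Idx p × LinkSpace) × (Fin p → ℝ) => (q.1.1, q.2)))
  exact continuous_eval.comp ((continuous_snd.comp continuous_fst).prodMk h1)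

theorem abs_linkFun_le (f : LinkSpace) (t : ℝ) : |linkFun f t| ≤ ‖f‖ :=
  f.norm_coe_le_norm _

/-- The difference `f⋆(θ⋆ᵀ x) - f(θᵀ x)` between the regression function and a predictor. -/
noncomputable def gap {p : ℕ} (θs : Idx p) (fs : ℝ → ℝ) (q : Idx p × LinkSpace) (x : Fin p → ℝ) : ℝ :=
  fs (dot θs x) - linkFun q.2 (dot q.1 x)

theorem measurable_gap {p : ℕ} {θs : Idx p} {fs : ℝ → ℝ} (hfs : Measurable fs) :
    Measurable fun r : (Idx p × LinkSpace) × (Fin p → ℝ) => gap θs fs r.1 r.2 := by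
  refine Measurable.sub ?_ continuous_linkFun_dot.measurable
  exact hfs.comp (continuous_dot.comp (by fun_prop :
    Continuous fun r : (Idx p × LinkSpace) × (Fin p → ℝ) => (θs, r.2))).measurable

theorem measurable_gap_right {p : ℕ} {θs : Idx p} {fs : ℝ → ℝ} (hfs : Measurable fs)
    (q : Idx p × LinkSpace) : Measurable (gap θs fs q) :=
  (measurable_gap hfs).comp (measurable_const.prodMk measurable_id)

theorem measurable_noise {p : ℕ} (θs : Idx p) {fs : ℝ → ℝ} (hfs : Measurable fs) :
    Measurable (noise θs fs) := by
  refine measurable_snd.sub (hfs.comp ?_)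
  exact (continuous_dot.comp (by fun_prop : Continuous fun z : Obs p => (θs, z.1))).measurable

/-- The excess loss `(Y - f(θᵀ X))² - (Y - f⋆(θ⋆ᵀ X))²`. -/
noncomputable def excessLoss {p : ℕ} (θs : Idx p) (fs : ℝ → ℝ) (q : Idx p × LinkSpace) (z : Obs p) : ℝ :=
  gap θs fs q z.1 ^ 2 + 2 * (gap θs fs q z.1 * noise θs fs z)

theorem excessLoss_eq {p : ℕ} (θs : Idx p) (fs : ℝ → ℝ) (q : Idx p × LinkSpace) (z : Obs p) :
    excessLoss θs fs q z =
      (z.2 - linkFun q.2 (dot q.1 z.1)) ^ 2 - (z.2 - fs (dot θs z.1)) ^ 2 := by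
  simp only [excessLoss, gap, noise]; ring

/-! ### Conditional moments and exponential moments of one excess loss. -/

section Model

variable {p : ℕ} {P : Measure (Obs p)} {θs : Idx p} {fs : ℝ → ℝ} {L C σ : ℝ}

theorem ae_abs_link_le (hM : IsSingleIndexModel P θs fs) (hB : AssumptionB P fs C) :
    ∀ᵐ z ∂P, |fs (dot θs z.1)| ≤ C := by
  filter_upwards [hB.1] with z hz
  exact hB.2 _ (dot_mem_Icc hM.index_mem hz)

theorem ae_abs_gap_le (hM : IsSingleIndexModel P θs fs) (hB : AssumptionB P fs C)
    (q : Idx p × LinkSpace) : ∀ᵐ z ∂P, |gap θs fs q z.1| ≤ C + ‖q.2‖ := by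
  filter_upwards [ae_abs_link_le hM hB] with z hz
  exact (abs_sub _ _).trans (add_le_add hz (abs_linkFun_le _ _))

theorem integrable_noise (hM : IsSingleIndexModel P θs fs) (hN : AssumptionN P θs fs L σ) :
    Integrable (noise θs fs) P := by
  have := hM.isProbabilityMeasure
  have h : MemLp (noise θs fs) 2 P := by
    rw [memLp_two_iff_integrable_sq (measurable_noise θs hM.measurable_link).aestronglyMeasurable]
    simpa using (hN 2 le_rfl).1
  exact h.integrable one_le_two

theorem integrable_bdd_mul {u g : Obs p → ℝ} (hu : Measurable u) (hg : Integrable g P) {c : ℝ}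
    (hb : ∀ᵐ z ∂P, |u z| ≤ c) : Integrable (fun z => u z * g z) P :=
  hg.bdd_mul hu.aestronglyMeasurable hb

/-- Bounded functions of `X` integrate against a function of `(X, Y)` as against its conditional
expectation given `X`. -/
theorem integral_mul_condExp_sigmaX [IsProbabilityMeasure P] {v : (Fin p → ℝ) → ℝ}
    (hv : Measurable v) {g : Obs p → ℝ} (hg : Integrable g P) {c : ℝ} (hb : ∀ᵐ z ∂P, |v z.1| ≤ c) :
    ∫ z, v z.1 * g z ∂P = ∫ z, v z.1 * (P[g | sigmaX p]) z ∂P := by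
  have hm : sigmaX p ≤ (Prod.instMeasurableSpace : MeasurableSpace (Obs p)) := measurable_fst.comap_le
  have hvm : StronglyMeasurable[sigmaX p] fun z : Obs p => v z.1 := by
    refine Measurable.stronglyMeasurable ?_
    exact hv.comp (comap_measurable Prod.fst)
  rw [← integral_condExp hm]
  exact integral_congr_ae (condExp_mul_of_stronglyMeasurable_left hvm
    (integrable_bdd_mul (hv.comp measurable_fst) hg hb) hg)

theorem integral_mul_noise_eq_zero (hM : IsSingleIndexModel P θs fs)
    (hN : AssumptionN P θs fs L σ) {v : (Fin p → ℝ) → ℝ} (hv : Measurable v) {c : ℝ}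
    (hb : ∀ᵐ z ∂P, |v z.1| ≤ c) : ∫ z, v z.1 * noise θs fs z ∂P = 0 := by
  have := hM.isProbabilityMeasure
  rw [integral_mul_condExp_sigmaX hv (integrable_noise hM hN) hb]
  refine integral_eq_zero_of_ae ?_
  filter_upwards [hM.noise_centered] with z hz
  simp [hz]

theorem integral_sq_mul_abs_noise_pow_le (hM : IsSingleIndexModel P θs fs)
    (hN : AssumptionN P θs fs L σ) {v : (Fin p → ℝ) → ℝ} (hv : Measurable v) {c : ℝ}
    (hb : ∀ᵐ z ∂P, |v z.1| ≤ c) {k : ℕ} (hk : 2 ≤ k) :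
    Integrable (fun z : Obs p => v z.1 ^ 2 * |noise θs fs z| ^ k) P ∧
    ∫ z, v z.1 ^ 2 * |noise θs fs z| ^ k ∂P
      ≤ ((k.factorial : ℝ) / 2 * σ ^ 2 * L ^ (k - 2)) * ∫ z, v z.1 ^ 2 ∂P := by
  have := hM.isProbabilityMeasure
  obtain ⟨hi, hle⟩ := hN k hk
  have hb2 : ∀ᵐ z ∂P, |v z.1 ^ 2| ≤ c ^ 2 := by
    filter_upwards [hb] with z hz
    rw [abs_pow]; gcongr
  have hv2 : Measurable fun x => v x ^ 2 := hv.pow_const 2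
  refine ⟨integrable_bdd_mul (hv2.comp measurable_fst) hi hb2, ?_⟩
  rw [integral_mul_condExp_sigmaX (v := fun x => v x ^ 2) hv2 hi hb2, ← integral_const_mul]
  have hint : Integrable (fun z : Obs p => v z.1 ^ 2) P := by
    simpa using integrable_bdd_mul (hv2.comp measurable_fst) (integrable_const (1 : ℝ)) hb2
  refine integral_mono_ae ?_ (hint.const_mul _) ?_
  · exact integrable_bdd_mul (hv2.comp measurable_fst) integrable_condExp hb2
  · filter_upwards [hle] with z hz
    rw [mul_comm]
    gcongr

theorem integrable_gap_sq (hM : IsSingleIndexModel P θs fs) (hB : AssumptionB P fs C)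
    (q : Idx p × LinkSpace) : Integrable (fun z : Obs p => gap θs fs q z.1 ^ 2) P := by
  have := hM.isProbabilityMeasure
  have hv2 : Measurable fun z : Obs p => gap θs fs q z.1 ^ 2 :=
    ((measurable_gap_right hM.measurable_link q).comp measurable_fst).pow_const 2
  have hb2 : ∀ᵐ z ∂P, |gap θs fs q z.1 ^ 2| ≤ (C + ‖q.2‖) ^ 2 := by
    filter_upwards [ae_abs_gap_le hM hB q] with z hz
    rw [abs_pow]; gcongr
  simpa using integrable_bdd_mul hv2 (integrable_const (1 : ℝ)) hb2

theorem integrable_excessLoss (hM : IsSingleIndexModel P θs fs) (hN : AssumptionN P θs fs L σ)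
    (hB : AssumptionB P fs C) (q : Idx p × LinkSpace) : Integrable (excessLoss θs fs q) P :=
  (integrable_gap_sq hM hB q).add ((integrable_bdd_mul
    ((measurable_gap_right hM.measurable_link q).comp measurable_fst) (integrable_noise hM hN)
      (ae_abs_gap_le hM hB q)).const_mul 2)

theorem integral_excessLoss (hM : IsSingleIndexModel P θs fs) (hN : AssumptionN P θs fs L σ)
    (hB : AssumptionB P fs C) (q : Idx p × LinkSpace) :
    ∫ z, excessLoss θs fs q z ∂P = ∫ z, gap θs fs q z.1 ^ 2 ∂P := by
  have hv := measurable_gap_right (θs := θs) hM.measurable_link q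
  have hb := ae_abs_gap_le hM hB q
  have hi : Integrable (fun z : Obs p => 2 * (gap θs fs q z.1 * noise θs fs z)) P :=
    (integrable_bdd_mul (hv.comp measurable_fst) (integrable_noise hM hN) hb).const_mul 2
  unfold excessLoss
  rw [integral_add (integrable_gap_sq hM hB q) hi, integral_const_mul,
    integral_mul_noise_eq_zero hM hN hv hb, mul_zero, add_zero]

/-- The excess risk is the squared `L²` distance to the regression function. -/
theorem predRisk_sub_predRisk (hM : IsSingleIndexModel P θs fs) (hN : AssumptionN P θs fs L σ)
    (hB : AssumptionB P fs C) (q : Idx p × LinkSpace) :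
    predRisk P q.1 (linkFun q.2) - predRisk P θs fs = ∫ z, gap θs fs q z.1 ^ 2 ∂P := by
  have hW : Integrable (fun z : Obs p => (z.2 - fs (dot θs z.1)) ^ 2) P := by
    simpa [noise] using (hN 2 le_rfl).1
  have h : predRisk P q.1 (linkFun q.2)
      = ∫ z, (excessLoss θs fs q z + (z.2 - fs (dot θs z.1)) ^ 2) ∂P := by
    unfold predRisk
    congr 1 with z
    rw [excessLoss_eq]; ring
  rw [h, integral_add (integrable_excessLoss hM hN hB q) hW, integral_excessLoss hM hN hB q]
  simp [predRisk]

/-- The powers of two come from `|2W + u|^k ≤ 2^(k-1) ((2|W|)^k + B^k)` with `k = j + 2`; the scale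
`8 B m` is large enough to absorb them. -/
theorem bernstein_constant_le {B m L σ : ℝ} (hB : 0 ≤ B) (hL : 0 ≤ L) (hLm : L ≤ m)
    (hBm : B ≤ m) (j : ℕ) :
    B ^ j * 2 ^ (j + 1) * (2 ^ (j + 2) * (((j + 2).factorial : ℝ) / 2 * σ ^ 2 * L ^ j) + B ^ (j + 2))
      ≤ ((j + 2).factorial : ℝ) / 2 * (2 * (B ^ 2 + 4 * σ ^ 2)) * (8 * B * m) ^ j := by
  have hF : (1 : ℝ) ≤ ((j + 2).factorial : ℝ) / 2 := by
    have h : 2 ≤ (j + 2).factorial := by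
      simpa using Nat.factorial_le (Nat.le_add_left 2 j)
    have : (2 : ℝ) ≤ ((j + 2).factorial : ℝ) := by exact_mod_cast h
    linarith
  set F := ((j + 2).factorial : ℝ) / 2
  have hm : 0 ≤ m := hL.trans hLm
  have h1 : (4 : ℝ) ^ j * L ^ j ≤ 8 ^ j * m ^ j := by gcongr; norm_num
  have h2 : (2 : ℝ) ^ j * B ^ j ≤ F * (8 ^ j * m ^ j) := by
    calc (2 : ℝ) ^ j * B ^ j ≤ 8 ^ j * m ^ j := by gcongr; norm_num
      _ ≤ F * (8 ^ j * m ^ j) := le_mul_of_one_le_left (by positivity) hF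
  have h4 : (4 : ℝ) ^ j = 2 ^ j * 2 ^ j := by rw [← mul_pow]; norm_num
  calc _ = 8 * F * σ ^ 2 * B ^ j * (4 ^ j * L ^ j) + 2 * B ^ 2 * B ^ j * (2 ^ j * B ^ j) := by
        rw [h4]; ring
    _ ≤ 8 * F * σ ^ 2 * B ^ j * (8 ^ j * m ^ j) + 2 * B ^ 2 * B ^ j * (F * (8 ^ j * m ^ j)) := by
        gcongr
    _ = _ := by rw [mul_pow, mul_pow]; ring

/-- In `T = u (2W + u)`, the factor `|u|^k` is split as `|u|^(k-2) u²` and only the first part is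
bounded by the constant `2C + 1`. Keeping `u²` makes the Bernstein variance proportional to the
excess risk. -/
theorem abs_excessLoss_moment_le (hM : IsSingleIndexModel P θs fs) (hN : AssumptionN P θs fs L σ)
    (hB : AssumptionB P fs C) (hL : 0 ≤ L) (hC : 0 ≤ C) {q : Idx p × LinkSpace}
    (hq : ‖q.2‖ ≤ C + 1) {k : ℕ} (hk : 2 ≤ k) :
    Integrable (fun z => |excessLoss θs fs q z| ^ k) P ∧
    ∫ z, |excessLoss θs fs q z| ^ k ∂P ≤ (k.factorial : ℝ) / 2 *
      (2 * ((2 * C + 1) ^ 2 + 4 * σ ^ 2) * ∫ z, gap θs fs q z.1 ^ 2 ∂P) *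
        (8 * (2 * C + 1) * max L (2 * C + 1)) ^ (k - 2) := by
  obtain ⟨j, rfl⟩ := Nat.exists_eq_add_of_le' hk
  have hv := measurable_gap_right (θs := θs) hM.measurable_link q
  have hb : ∀ᵐ z ∂P, |gap θs fs q z.1| ≤ 2 * C + 1 := by
    filter_upwards [ae_abs_gap_le hM hB q] with z hz
    linarith
  have hB0 : 0 ≤ 2 * C + 1 := by linarith
  set B := 2 * C + 1
  obtain ⟨hi, hle⟩ := integral_sq_mul_abs_noise_pow_le hM hN hv hb hk
  have hgi := integrable_gap_sq hM hB q
  set D := ∫ z, gap θs fs q z.1 ^ 2 ∂P with hD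
  have hdom_int : Integrable (fun z : Obs p => B ^ j * 2 ^ (j + 1) *
      (2 ^ (j + 2) * (gap θs fs q z.1 ^ 2 * |noise θs fs z| ^ (j + 2))
        + B ^ (j + 2) * gap θs fs q z.1 ^ 2)) P :=
    ((hi.const_mul _).add (hgi.const_mul _)).const_mul _
  have hdom : ∀ᵐ z ∂P, |excessLoss θs fs q z| ^ (j + 2) ≤ B ^ j * 2 ^ (j + 1) *
      (2 ^ (j + 2) * (gap θs fs q z.1 ^ 2 * |noise θs fs z| ^ (j + 2))
        + B ^ (j + 2) * gap θs fs q z.1 ^ 2) := by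
    filter_upwards [hb] with z hz
    have he : excessLoss θs fs q z
        = gap θs fs q z.1 * (2 * noise θs fs z + gap θs fs q z.1) := by
      unfold excessLoss; ring
    set u := gap θs fs q z.1
    set W := noise θs fs z
    have hsum : |2 * W + u| ^ (j + 2) ≤ 2 ^ (j + 1) * ((2 * |W|) ^ (j + 2) + B ^ (j + 2)) := by
      calc |2 * W + u| ^ (j + 2) ≤ (2 * |W| + B) ^ (j + 2) := by
            gcongr
            refine (abs_add_le _ _).trans ?_
            rw [abs_mul, abs_two]
            gcongr
        _ ≤ _ := add_pow_le (by positivity) hB0 _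
    rw [he, abs_mul, mul_pow]
    calc |u| ^ (j + 2) * |2 * W + u| ^ (j + 2)
        = |u| ^ j * u ^ 2 * |2 * W + u| ^ (j + 2) := by rw [pow_add, sq_abs]
      _ ≤ B ^ j * u ^ 2 * (2 ^ (j + 1) * ((2 * |W|) ^ (j + 2) + B ^ (j + 2))) := by gcongr
      _ = _ := by rw [mul_pow]; ring
  have hTm : AEStronglyMeasurable (fun z => |excessLoss θs fs q z| ^ (j + 2)) P := by
    have h := (integrable_excessLoss hM hN hB q).aestronglyMeasurable.norm.pow (j + 2)
    exact h
  have hint : Integrable (fun z => |excessLoss θs fs q z| ^ (j + 2)) P := by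
    refine hdom_int.mono' hTm ?_
    filter_upwards [hdom] with z hz
    rwa [Real.norm_of_nonneg (by positivity)]
  refine ⟨hint, (integral_mono_ae hint hdom_int hdom).trans ?_⟩
  rw [integral_const_mul, integral_add (hi.const_mul _) (hgi.const_mul _), integral_const_mul,
    integral_const_mul, ← hD]
  have hD0 : 0 ≤ D := integral_nonneg fun z => sq_nonneg _
  rw [Nat.add_sub_cancel] at hle ⊢
  calc B ^ j * 2 ^ (j + 1) * (2 ^ (j + 2) * (∫ z, gap θs fs q z.1 ^ 2 * |noise θs fs z| ^ (j + 2) ∂P)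
        + B ^ (j + 2) * D)
      ≤ B ^ j * 2 ^ (j + 1) * (2 ^ (j + 2) * (((j + 2).factorial : ℝ) / 2 * σ ^ 2 * L ^ j * D)
        + B ^ (j + 2) * D) := by gcongr
    _ = B ^ j * 2 ^ (j + 1) * (2 ^ (j + 2) * (((j + 2).factorial : ℝ) / 2 * σ ^ 2 * L ^ j)
        + B ^ (j + 2)) * D := by ring
    _ ≤ ((j + 2).factorial : ℝ) / 2 * (2 * (B ^ 2 + 4 * σ ^ 2)) * (8 * B * max L B) ^ j * D := by
        exact mul_le_mul_of_nonneg_right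
          (bernstein_constant_le hB0 hL (le_max_left _ _) (le_max_right _ _) j) hD0
    _ = _ := by ring

/-- The inverse temperature per observation. -/
noncomputable def unitTemp (L C σ : ℝ) : ℝ :=
  1 / (8 * (2 * C + 1) * max L (2 * C + 1) + 2 * ((2 * C + 1) ^ 2 + 4 * σ ^ 2))

theorem unitTemp_pos (hC : 0 ≤ C) : 0 < unitTemp L C σ := by
  unfold unitTemp
  have : 0 < max L (2 * C + 1) := lt_max_of_lt_right (by linarith)
  positivity

theorem invTemp_eq (n : ℕ) : invTemp n L C σ = n * unitTemp L C σ := by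
  unfold invTemp unitTemp; ring

/-- With `s = 1 / (w + v)`, one has `1 - s w = s v`, so the term `s² v D / (2 (1 - s w))` collapses
to `s D / 2`. This is what dictates the temperature. -/
theorem bernstein_exponent (hC : 0 ≤ C) (D : ℝ) :
    unitTemp L C σ * (8 * (2 * C + 1) * max L (2 * C + 1)) < 1 ∧
    unitTemp L C σ ^ 2 * (2 * ((2 * C + 1) ^ 2 + 4 * σ ^ 2) * D) /
      (2 * (1 - unitTemp L C σ * (8 * (2 * C + 1) * max L (2 * C + 1)))) =
        unitTemp L C σ * D / 2 := by
  have hm : 0 < max L (2 * C + 1) := lt_max_of_lt_right (by linarith)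
  have hv : 0 < 2 * ((2 * C + 1) ^ 2 + 4 * σ ^ 2) := by positivity
  have hw : 0 < 8 * (2 * C + 1) * max L (2 * C + 1) := by positivity
  unfold unitTemp
  generalize 2 * ((2 * C + 1) ^ 2 + 4 * σ ^ 2) = v at *
  generalize 8 * (2 * C + 1) * max L (2 * C + 1) = w at *
  have h1 : 1 - 1 / (w + v) * w = v / (w + v) := by field_simp; ring
  refine ⟨?_, ?_⟩
  · rw [div_mul_eq_mul_div, one_mul, div_lt_one (by positivity)]; linarith
  · rw [h1]; field_simp

/-- The mean contributes `-s D` and the fluctuations at most `s D / 2`, so half of the drift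
survives. -/
theorem lintegral_exp_neg_excessLoss_le (hM : IsSingleIndexModel P θs fs)
    (hN : AssumptionN P θs fs L σ) (hB : AssumptionB P fs C) (hL : 0 ≤ L) (hC : 0 ≤ C)
    {q : Idx p × LinkSpace} (hq : ‖q.2‖ ≤ C + 1) :
    ∫⁻ z, ENNReal.ofReal (Real.exp (-(unitTemp L C σ * excessLoss θs fs q z))) ∂P
      ≤ ENNReal.ofReal (Real.exp (-(unitTemp L C σ * (∫ z, gap θs fs q z.1 ^ 2 ∂P) / 2))) := by
  have := hM.isProbabilityMeasure
  have hm : 0 ≤ max L (2 * C + 1) := hL.trans (le_max_left _ _)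
  obtain ⟨h1, h2⟩ := bernstein_exponent (L := L) (σ := σ) hC (∫ z, gap θs fs q z.1 ^ 2 ∂P)
  have h := lintegral_exp_le_of_moments P (integrable_excessLoss hM hN hB q).neg
    (w := 8 * (2 * C + 1) * max L (2 * C + 1))
    (v := 2 * ((2 * C + 1) ^ 2 + 4 * σ ^ 2) * ∫ z, gap θs fs q z.1 ^ 2 ∂P) (by positivity)
    (unitTemp_pos hC).le h1 (fun k hk => by
      simpa using abs_excessLoss_moment_le hM hN hB hL hC hq hk)
  rw [h2] at h
  simp only [Pi.neg_apply, integral_neg, integral_excessLoss hM hN hB q, mul_neg] at h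
  refine h.trans (ENNReal.ofReal_le_ofReal (Real.exp_le_exp.2 ?_))
  linarith

theorem lintegral_exp_excessLoss_le (hM : IsSingleIndexModel P θs fs)
    (hN : AssumptionN P θs fs L σ) (hB : AssumptionB P fs C) (hL : 0 ≤ L) (hC : 0 ≤ C)
    {q : Idx p × LinkSpace} (hq : ‖q.2‖ ≤ C + 1) :
    ∫⁻ z, ENNReal.ofReal (Real.exp (unitTemp L C σ * excessLoss θs fs q z)) ∂P
      ≤ ENNReal.ofReal (Real.exp (3 / 2 * (unitTemp L C σ * ∫ z, gap θs fs q z.1 ^ 2 ∂P))) := by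
  have := hM.isProbabilityMeasure
  have hm : 0 ≤ max L (2 * C + 1) := hL.trans (le_max_left _ _)
  obtain ⟨h1, h2⟩ := bernstein_exponent (L := L) (σ := σ) hC (∫ z, gap θs fs q z.1 ^ 2 ∂P)
  have h := lintegral_exp_le_of_moments P (integrable_excessLoss hM hN hB q)
    (w := 8 * (2 * C + 1) * max L (2 * C + 1))
    (v := 2 * ((2 * C + 1) ^ 2 + 4 * σ ^ 2) * ∫ z, gap θs fs q z.1 ^ 2 ∂P) (by positivity)
    (unitTemp_pos hC).le h1 (fun k hk => abs_excessLoss_moment_le hM hN hB hL hC hq hk)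
  rw [h2, integral_excessLoss hM hN hB q] at h
  refine h.trans (ENNReal.ofReal_le_ofReal (Real.exp_le_exp.2 ?_))
  linarith

end Model

/-! ### Small balls under the prior on indexes -/

theorem measurable_idx_apply {p : ℕ} (j : Fin p) : Measurable fun θ : Idx p => θ j :=
  (by fun_prop : Continuous fun θ : Idx p => θ j).measurable

theorem measurableSet_sphereOn {p : ℕ} (I : Finset (Fin p)) : MeasurableSet (sphereOn I) := by
  have h0 : ∀ j : Fin p, MeasurableSet {θ : Idx p | θ j = 0} := fun j =>
    measurable_idx_apply j (measurableSet_singleton 0)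
  have h1 : MeasurableSet {θ : Idx p | ∑ j, |θ j| = 1} :=
    (by fun_prop : Continuous fun θ : Idx p => ∑ j, |θ j|).measurable (measurableSet_singleton 1)
  have h2 : ∀ j : Fin p, MeasurableSet
      {θ : Idx p | θ j ≠ 0 → (∀ i, i < j → θ i = 0) → 0 < θ j} := by
    intro j
    have h3 : MeasurableSet {θ : Idx p | ∀ i, i < j → θ i = 0} := by
      simp only [Set.ofPred_forall]
      exact MeasurableSet.iInter fun i => MeasurableSet.iInter fun _ => h0 i
    exact (h0 j).compl.imp (h3.imp (measurableSet_lt measurable_const (measurable_idx_apply j)))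
  have h4 : ∀ j : Fin p, MeasurableSet {θ : Idx p | θ j = 0 ↔ j ∉ I} := fun j =>
    (h0 j).iff (MeasurableSet.const _)
  have h5 : MeasurableSet {θ : Idx p | ∀ j, θ j ≠ 0 → (∀ i, i < j → θ i = 0) → 0 < θ j} := by
    simp only [Set.ofPred_forall]
    exact MeasurableSet.iInter h2
  have h6 : MeasurableSet {θ : Idx p | ∀ j, θ j = 0 ↔ j ∉ I} := by
    simp only [Set.ofPred_forall]
    exact MeasurableSet.iInter h4
  exact (h1.inter h5).inter h6

/-- The open face of the `ℓ¹`-sphere on which the coordinates in `I` are positive and the others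
vanish. -/
def posFace {p : ℕ} (I : Finset (Fin p)) : Set (Idx p) :=
  {θ | ∑ j, |θ j| = 1 ∧ ∀ j, if j ∈ I then 0 < θ j else θ j = 0}

/-- Change of sign of the coordinates in `S`. -/
noncomputable def reflect {p : ℕ} (S : Finset (Fin p)) : Idx p ≃ₗᵢ[ℝ] Idx p :=
  LinearIsometryEquiv.piLpCongrRight 2 fun j =>
    if j ∈ S then LinearIsometryEquiv.neg ℝ else LinearIsometryEquiv.refl ℝ ℝ

theorem reflect_apply {p : ℕ} (S : Finset (Fin p)) (θ : Idx p) (j : Fin p) :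
    reflect S θ j = if j ∈ S then -θ j else θ j := by
  simp only [reflect, LinearIsometryEquiv.piLpCongrRight_apply]
  split_ifs <;> simp

theorem reflect_reflect {p : ℕ} (S : Finset (Fin p)) (θ : Idx p) :
    reflect S (reflect S θ) = θ := by
  ext j
  simp only [reflect_apply]
  split_ifs <;> simp

/-- The coordinates at which `θ` is negative. -/
noncomputable def negPart {p : ℕ} (θ : Idx p) : Finset (Fin p) := Finset.univ.filter fun j => θ j < 0

theorem reflect_mem_posFace {p : ℕ} {I : Finset (Fin p)} {θ : Idx p} (hθ : θ ∈ sphereOn I) :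
    reflect (negPart θ) θ ∈ posFace I := by
  have habs : ∀ j, reflect (negPart θ) θ j = |θ j| := by
    intro j
    simp only [reflect_apply, negPart, Finset.mem_filter, Finset.mem_univ, true_and]
    split_ifs with h
    · rw [abs_of_neg h]
    · rw [abs_of_nonneg (not_lt.1 h)]
  refine ⟨by simpa [habs] using hθ.1.1, fun j => ?_⟩
  rw [habs]
  have := hθ.2 j
  split_ifs with h
  · exact abs_pos.2 fun h0 => this.1 h0 h
  · rw [this.2 h, abs_zero]

theorem negPart_subset {p : ℕ} {I : Finset (Fin p)} {θ : Idx p} (hθ : θ ∈ sphereOn I) :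
    negPart θ ⊆ I := by
  intro j hj
  by_contra h
  have h0 := (hθ.2 j).2 h
  simp [negPart, h0] at hj

/-- Only sign patterns supported in `I` matter, so `2^|I|` isometric copies of one face suffice.
Some copies violate the sign convention, which is harmless for an upper bound. -/
theorem sphereOn_subset_iUnion {p : ℕ} (I : Finset (Fin p)) :
    sphereOn I ⊆ ⋃ S ∈ I.powerset, reflect S '' posFace I := by
  intro θ hθ
  simp only [Set.mem_iUnion, Finset.mem_powerset]
  exact ⟨negPart θ, negPart_subset hθ, _, reflect_mem_posFace hθ, reflect_reflect _ _⟩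

/-- A point of the face of `θ₀`, moved towards `θ₀`, stays in the face of `θ₀`. -/
theorem homothety_mem_sphereOn {p : ℕ} {I : Finset (Fin p)} {θ₀ η : Idx p}
    (hθ : θ₀ ∈ sphereOn I) (hη : η ∈ posFace I) {ε : ℝ} (h0 : 0 < ε) (h1 : ε ≤ 1) :
    AffineMap.homothety θ₀ ε (reflect (negPart θ₀) η) ∈
      sphereOn I ∩ {θ : Idx p | ∑ j, |θ j - θ₀ j| ≤ 2 * ε} := by
  have hcoord : ∀ j, AffineMap.homothety θ₀ ε (reflect (negPart θ₀) η) j =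
      (if θ₀ j < 0 then -1 else 1) * ((1 - ε) * |θ₀ j| + ε * |η j|) ∧
      |AffineMap.homothety θ₀ ε (reflect (negPart θ₀) η) j - θ₀ j| ≤ ε * (|θ₀ j| + |η j|) := by
    intro j
    have hηj : |η j| = η j := by
      have := hη.2 j
      split_ifs at this with h
      · exact abs_of_pos this
      · rw [this, abs_zero]
    have hb : |reflect (negPart θ₀) η j - θ₀ j| ≤ |θ₀ j| + |η j| := by
      rw [reflect_apply, add_comm]
      split_ifs
      · rw [← abs_neg (η j)]; exact abs_sub _ _
      · exact abs_sub _ _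
    have hd : AffineMap.homothety θ₀ ε (reflect (negPart θ₀) η) j =
        ε * (reflect (negPart θ₀) η j - θ₀ j) + θ₀ j := by
      simp [AffineMap.homothety_apply]
    refine ⟨?_, ?_⟩
    · rw [hd, reflect_apply, hηj]
      simp only [negPart, Finset.mem_filter, Finset.mem_univ, true_and]
      split_ifs with h
      · rw [abs_of_neg h]; ring
      · rw [abs_of_nonneg (not_lt.1 h)]; ring
    · rw [hd, add_sub_cancel_right, abs_mul, abs_of_pos h0]
      gcongr
  generalize AffineMap.homothety θ₀ ε (reflect (negPart θ₀) η) = ζ at hcoord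
  have hpos : ∀ j ∈ I, 0 < (1 - ε) * |θ₀ j| + ε * |η j| := by
    intro j hj
    have h2 := hη.2 j
    rw [if_pos hj] at h2
    have : 0 ≤ (1 - ε) * |θ₀ j| := mul_nonneg (by linarith) (abs_nonneg _)
    have : 0 < ε * |η j| := mul_pos h0 (abs_pos.2 h2.ne')
    linarith
  have hzero : ∀ j, θ₀ j = 0 ↔ ζ j = 0 := by
    intro j
    rw [hθ.2 j, (hcoord j).1]
    by_cases hj : j ∈ I
    · have := (hpos j hj).ne'
      have h3 : (if θ₀ j < 0 then (-1 : ℝ) else 1) ≠ 0 := by split_ifs <;> norm_num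
      exact iff_of_false (not_not.2 hj) (mul_ne_zero h3 this)
    · have h2 := hη.2 j
      rw [if_neg hj] at h2
      simp [hj, h2, (hθ.2 j).2 hj]
  have habs : ∀ j, |ζ j| = (1 - ε) * |θ₀ j| + ε * |η j| := by
    intro j
    have h3 : |(if θ₀ j < 0 then (-1 : ℝ) else 1)| = 1 := by split_ifs <;> norm_num
    have h4 : 0 ≤ (1 - ε) * |θ₀ j| := mul_nonneg (by linarith) (abs_nonneg _)
    rw [(hcoord j).1, abs_mul, h3, one_mul, abs_of_nonneg (by positivity)]
  refine ⟨⟨⟨?_, ?_⟩, fun j => by rw [← hzero j]; exact hθ.2 j⟩, ?_⟩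
  · simp_rw [habs]
    rw [Finset.sum_add_distrib, ← Finset.mul_sum, ← Finset.mul_sum, hθ.1.1, hη.1]
    ring
  · intro j hj hlt
    have h5 : 0 < θ₀ j := hθ.1.2 j (fun h => hj ((hzero j).1 h)) fun i hi => (hzero i).2 (hlt i hi)
    rw [(hcoord j).1, if_neg h5.not_gt, one_mul]
    exact hpos j (by
      by_contra h
      exact h5.ne' ((hθ.2 j).2 h))
  · change ∑ j, |ζ j - θ₀ j| ≤ 2 * ε
    calc ∑ j, |ζ j - θ₀ j| ≤ ∑ j, ε * (|θ₀ j| + |η j|) :=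
          Finset.sum_le_sum fun j _ => (hcoord j).2
      _ = 2 * ε := by
          rw [← Finset.mul_sum, Finset.sum_add_distrib, hθ.1.1, hη.1]; ring

/-! ### Hausdorff measure of an open face of the `ℓ¹`-sphere. -/

section Face

variable {p : ℕ} (I : Finset (Fin p)) (j₀ : Fin p)

/-- The direction part of the affine parametrization of the face of `I` by the coordinates other
than `j₀`. -/
noncomputable def faceParam : ((I.erase j₀) → ℝ) →ₗ[ℝ] Idx p where
  toFun x := ∑ i, x i • (EuclideanSpace.single (i : Fin p) (1 : ℝ) - EuclideanSpace.single j₀ 1)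
  map_add' x y := by simp [add_smul, Finset.sum_add_distrib]
  map_smul' c x := by simp [Finset.smul_sum, mul_smul]

/-- The face lies in a Lipschitz image of the cube `[0,1]^(I \ {j₀})`: the coordinate `j₀` is one
minus the sum of the others. -/
theorem hausdorffMeasure_posFace_ne_top (hj : j₀ ∈ I) :
    Measure.hausdorffMeasure ((I.card : ℝ) - 1) (posFace I) ≠ ∞ := by
  have hd : (I.card : ℝ) - 1 = (Fintype.card (I.erase j₀) : ℝ) := by
    rw [Fintype.card_coe, ← Finset.card_erase_add_one hj]; simp
  rw [hd]
  have hlip := ((isometry_add_left (EuclideanSpace.single j₀ (1 : ℝ) : Idx p)).lipschitz).comp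
    (faceParam I j₀).toContinuousLinearMap.lipschitz
  refine ne_top_of_le_ne_top ?_ ((measure_mono ?_).trans
    (hlip.hausdorffMeasure_image_le (Nat.cast_nonneg _) (Set.Icc 0 1)))
  · rw [hausdorffMeasure_pi_real]
    exact ENNReal.mul_ne_top (by simp) (isCompact_Icc.measure_lt_top.ne)
  · rintro θ ⟨hsum, hθ⟩
    have hnn : ∀ j, 0 ≤ θ j := fun j => by
      have := hθ j
      split_ifs at this
      · exact this.le
      · exact this.ge
    simp_rw [abs_of_nonneg (hnn _)] at hsum
    refine ⟨fun i => θ i, ⟨fun i => hnn i, fun i => ?_⟩, ?_⟩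
    · rw [Pi.one_apply, ← hsum]
      exact Finset.single_le_sum (f := fun j => θ j) (fun j _ => hnn j) (Finset.mem_univ _)
    · ext j
      have hI : ∑ i ∈ I, θ i = 1 := by
        rw [← hsum]
        refine Finset.sum_subset (Finset.subset_univ _) fun j _ hj => ?_
        simpa [hj] using hθ j
      have hsplit : ∑ i ∈ I.erase j₀, θ i = 1 - θ j₀ := by
        rw [← hI, ← Finset.add_sum_erase _ _ hj]; ring
      have hc : (∑ i : I.erase j₀, θ (i : Fin p) • (EuclideanSpace.single (i : Fin p) (1 : ℝ)
          - EuclideanSpace.single j₀ 1) : Idx p) j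
          = ∑ i ∈ I.erase j₀, θ i * ((if j = i then 1 else 0) - (if j = j₀ then 1 else 0)) := by
        rw [← Finset.sum_coe_sort (I.erase j₀)]
        simp [WithLp.ofLp_sum, Finset.sum_apply, Pi.single_apply]
      change (EuclideanSpace.single j₀ (1 : ℝ) + ∑ i : I.erase j₀, θ (i : Fin p) •
        (EuclideanSpace.single (i : Fin p) (1 : ℝ) - EuclideanSpace.single j₀ 1) : Idx p) j = θ j
      rw [PiLp.add_apply, hc]
      simp only [mul_sub, Finset.sum_sub_distrib, mul_ite, mul_one, mul_zero, Finset.sum_ite_eq]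
      by_cases hjj : j = j₀
      · subst hjj
        simp [hsplit]
      · by_cases hjI : j ∈ I
        · simp [hjj, hjI]
        · have := hθ j
          rw [if_neg hjI] at this
          simp [hjj, hjI, this]

/-- Forgetting the coordinate `j₀` is 1-Lipschitz and maps the face onto a set containing a nonempty
open simplex, which has positive Lebesgue measure. -/
theorem hausdorffMeasure_posFace_ne_zero (hj : j₀ ∈ I) :
    Measure.hausdorffMeasure ((I.card : ℝ) - 1) (posFace I) ≠ 0 := by
  have hd : (I.card : ℝ) - 1 = (Fintype.card (I.erase j₀) : ℝ) := by
    rw [Fintype.card_coe, ← Finset.card_erase_add_one hj]; simp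
  rw [hd]
  have hlip : LipschitzWith 1 fun (θ : Idx p) (i : I.erase j₀) => θ (i : Fin p) := by
    refine LipschitzWith.of_dist_le_mul fun θ η => ?_
    rw [NNReal.coe_one, one_mul, dist_pi_le_iff dist_nonneg]
    exact fun i => PiLp.dist_apply_le θ η i
  have himg := hlip.hausdorffMeasure_image_le (Nat.cast_nonneg (Fintype.card (I.erase j₀)))
    (posFace I)
  rw [hausdorffMeasure_pi_real] at himg
  intro h0
  rw [h0, mul_zero] at himg
  have hopen : IsOpen {x : (I.erase j₀) → ℝ | (∀ i, 0 < x i) ∧ ∑ i, x i < 1} := by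
    have h1 : IsOpen {x : (I.erase j₀) → ℝ | ∀ i, 0 < x i} := by
      simp only [Set.ofPred_forall]
      exact isOpen_iInter_of_finite fun i => isOpen_lt continuous_const (continuous_apply i)
    have h2 : IsOpen {x : (I.erase j₀) → ℝ | ∑ i, x i < 1} :=
      isOpen_lt (by fun_prop) continuous_const
    exact h1.inter h2
  have hne : {x : (I.erase j₀) → ℝ | (∀ i, 0 < x i) ∧ ∑ i, x i < 1}.Nonempty := by
    refine ⟨fun _ => 1 / ((Fintype.card (I.erase j₀) : ℝ) + 1), fun i => by positivity, ?_⟩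
    rw [Finset.sum_const, Finset.card_univ, nsmul_eq_mul, mul_one_div, div_lt_one (by positivity)]
    linarith
  refine (hopen.measure_pos volume hne).ne' (le_antisymm ((measure_mono ?_).trans himg) zero_le)
  rintro x ⟨hx, hsum⟩
  -- Preimage of `x` under the projection: the missing mass goes to `j₀`, and zero outside `I`.
  have hval : ∀ j : Fin p, ∃ y : ℝ, y =
      if h : j ∈ I.erase j₀ then x ⟨j, h⟩ else if j = j₀ then 1 - ∑ i, x i else 0 :=
    fun j => ⟨_, rfl⟩
  choose y hy using hval
  have hy1 : ∀ i : I.erase j₀, y i = x i := fun i => by rw [hy, dif_pos i.2]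
  have hy0 : y j₀ = 1 - ∑ i, x i := by rw [hy]; simp
  have hyn : ∀ j, j ∉ I → y j = 0 := by
    intro j hjI
    have h1 : j ≠ j₀ := fun h => hjI (h ▸ hj)
    rw [hy]; simp [hjI, h1]
  have hyp : ∀ j ∈ I, 0 < y j := by
    intro j hjI
    by_cases h : j = j₀
    · rw [h, hy0]; linarith
    · have := hy1 ⟨j, Finset.mem_erase.2 ⟨h, hjI⟩⟩
      rw [this]; exact hx _
  refine ⟨WithLp.toLp 2 y, ⟨?_, fun j => ?_⟩, ?_⟩
  · change ∑ j, |y j| = 1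
    rw [← Finset.sum_subset (Finset.subset_univ I) fun j _ h => by rw [hyn j h, abs_zero],
      Finset.sum_congr rfl fun j h => abs_of_pos (hyp j h), ← Finset.add_sum_erase _ _ hj,
      ← Finset.sum_coe_sort, hy0]
    simp [hy1]
  · change if j ∈ I then 0 < y j else y j = 0
    split_ifs with h
    · exact hyp j h
    · exact hyn j h
  · funext i
    exact hy1 i

end Face

/-- The face containing `θ₀`, contracted towards `θ₀` by `ε`, stays in the model and within
`ℓ¹`-distance `2ε` of `θ₀`. It has measure `ε^(|I|-1)` times that of a face, while the whole model
is covered by `2^|I|` faces. -/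
theorem uniformIdx_ball_ge {p : ℕ} {I : Finset (Fin p)} (hI : I.Nonempty) {θ₀ : Idx p}
    (hθ : θ₀ ∈ sphereOn I) {ε : ℝ} (h0 : 0 < ε) (h1 : ε ≤ 1) :
    ENNReal.ofReal (ε / 2) ^ I.card ≤ uniformIdx I {θ : Idx p | ∑ j, |θ j - θ₀ j| ≤ 2 * ε} := by
  obtain ⟨j₀, hj⟩ := hI
  have hd : 0 ≤ (I.card : ℝ) - 1 := by
    have : 1 ≤ I.card := Finset.card_pos.2 ⟨j₀, hj⟩
    have : (1 : ℝ) ≤ I.card := by exact_mod_cast this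
    linarith
  have htop := hausdorffMeasure_posFace_ne_top I j₀ hj
  have hzero := hausdorffMeasure_posFace_ne_zero I j₀ hj
  set H : Measure (Idx p) := Measure.hausdorffMeasure ((I.card : ℝ) - 1) with hH
  have hrefl : ∀ S, H (reflect S '' posFace I) = H (posFace I) := fun S =>
    (reflect S).isometry.hausdorffMeasure_image (Or.inl hd) _
  have hupper : H (sphereOn I) ≤ 2 ^ I.card * H (posFace I) := by
    refine (measure_mono (sphereOn_subset_iUnion I)).trans
      ((measure_biUnion_finset_le _ _).trans ?_)
    simp [hrefl]
  have hlower : ENNReal.ofReal ε ^ I.card * H (posFace I) ≤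
      H (sphereOn I ∩ {θ : Idx p | ∑ j, |θ j - θ₀ j| ≤ 2 * ε}) := by
    have himg : H (AffineMap.homothety θ₀ ε '' (reflect (negPart θ₀) '' posFace I)) ≤
        H (sphereOn I ∩ {θ : Idx p | ∑ j, |θ j - θ₀ j| ≤ 2 * ε}) := by
      refine measure_mono ?_
      rintro _ ⟨_, ⟨η, hη, rfl⟩, rfl⟩
      exact homothety_mem_sphereOn hθ hη h0 h1
    refine le_trans ?_ himg
    rw [hH, hausdorffMeasure_homothety_image hd θ₀ h0.ne', ← hH, hrefl, ENNReal.smul_def,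
      smul_eq_mul]
    gcongr
    have hn : ‖ε‖₊ = ε.toNNReal := by
      ext; simp [h0.le]
    rw [ENNReal.ofReal, ← ENNReal.coe_pow, ENNReal.coe_le_coe, hn, ← NNReal.rpow_natCast]
    -- As `ε ≤ 1`, the scaling `ε^(|I|-1)` may be weakened to `ε^|I|`.
    exact NNReal.rpow_le_rpow_of_exponent_ge (Real.toNNReal_pos.2 h0) (by simpa using h1)
      (by linarith)
  have hpow0 : (2 : ℝ≥0∞) ^ I.card ≠ 0 := by positivity
  have hpowt : (2 : ℝ≥0∞) ^ I.card ≠ ∞ := ENNReal.pow_ne_top (by simp)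
  rw [uniformIdx, cond_apply (measurableSet_sphereOn I)]
  calc ENNReal.ofReal (ε / 2) ^ I.card
      = (2 ^ I.card * H (posFace I))⁻¹ * (ENNReal.ofReal ε ^ I.card * H (posFace I)) := by
        rw [ENNReal.ofReal_div_of_pos two_pos, ENNReal.ofReal_ofNat, div_eq_mul_inv, mul_pow,
          ENNReal.mul_inv (Or.inl hpow0) (Or.inl hpowt), ← ENNReal.inv_pow,
          mul_mul_mul_comm, ENNReal.inv_mul_cancel hzero htop, mul_one, mul_comm]
    _ ≤ _ := by gcongr

/-! ### Weights of the mixture over models. -/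

theorem inv_sum_tenth_pow_mul_le_one {w : ℕ → ℝ≥0∞} (hw : ∀ i, w i ≤ 1) (m : ℕ) :
    (∑ i ∈ Finset.Icc 1 m, (10 : ℝ≥0∞)⁻¹ ^ i)⁻¹ * ∑ i ∈ Finset.Icc 1 m, (10 : ℝ≥0∞)⁻¹ ^ i * w i
      ≤ 1 := by
  calc _ ≤ (∑ i ∈ Finset.Icc 1 m, (10 : ℝ≥0∞)⁻¹ ^ i)⁻¹ *
        ∑ i ∈ Finset.Icc 1 m, (10 : ℝ≥0∞)⁻¹ ^ i := by
        gcongr with i _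
        exact mul_le_of_le_one_right' (hw i)
    _ ≤ 1 := ENNReal.inv_mul_le_one _

/-- The geometric weights sum to at most one, so normalizing only increases them and can be dropped
in lower bounds. -/
theorem one_le_inv_sum_tenth_pow (m : ℕ) :
    1 ≤ (∑ i ∈ Finset.Icc 1 m, (10 : ℝ≥0∞)⁻¹ ^ i)⁻¹ := by
  rw [ENNReal.one_le_inv]
  have h : ∀ k : ℕ, ∑ i ∈ Finset.Icc 1 k, (10 : ℝ)⁻¹ ^ i ≤ 1 - 10⁻¹ ^ k := by
    intro k
    induction k with
    | zero => simp
    | succ k ih =>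
      rw [Finset.sum_Icc_succ_top (by omega), pow_succ]
      have : (0 : ℝ) ≤ 10⁻¹ ^ k := by positivity
      linarith
  have h10 : (10 : ℝ≥0∞)⁻¹ = ENNReal.ofReal 10⁻¹ := by
    rw [ENNReal.ofReal_inv_of_pos (by norm_num), ENNReal.ofReal_ofNat]
  simp_rw [h10, ← ENNReal.ofReal_pow (show (0 : ℝ) ≤ 10⁻¹ by norm_num)]
  rw [← ENNReal.ofReal_sum_of_nonneg fun i _ => by positivity, ENNReal.ofReal_le_one]
  have : (0 : ℝ) ≤ 10⁻¹ ^ m := by positivity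
  linarith [h m]

instance {p : ℕ} (I : Finset (Fin p)) : IsZeroOrProbabilityMeasure (uniformIdx I) := by
  unfold uniformIdx; infer_instance

theorem priorIdx_univ_le (p : ℕ) : priorIdx p Set.univ ≤ 1 := by
  unfold priorIdx
  simp only [Measure.smul_apply, Measure.finsetSum_apply, smul_eq_mul]
  refine inv_sum_tenth_pow_mul_le_one (w := fun i => ∑ I ∈ Finset.powersetCard i
    (Finset.univ : Finset (Fin p)), ((p.choose i : ℕ) : ℝ≥0∞)⁻¹ * uniformIdx I Set.univ)
    (fun i => ?_) p
  calc _ ≤ ∑ I ∈ Finset.powersetCard i (Finset.univ : Finset (Fin p)),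
        ((p.choose i : ℕ) : ℝ≥0∞)⁻¹ := by
        refine Finset.sum_le_sum fun I _ => mul_le_of_le_one_right' prob_le_one
    _ = (p.choose i : ℝ≥0∞) * (p.choose i : ℝ≥0∞)⁻¹ := by simp
    _ ≤ 1 := ENNReal.mul_inv_le_one _

theorem priorIdx_ge {p : ℕ} {I : Finset (Fin p)} (hI : I.Nonempty) (A : Set (Idx p)) :
    ((10 : ℝ≥0∞) * p)⁻¹ ^ I.card * uniformIdx I A ≤ priorIdx p A := by
  have hmem : I.card ∈ Finset.Icc 1 p :=
    Finset.mem_Icc.2 ⟨hI.card_pos, by simpa using Finset.card_le_univ I⟩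
  unfold priorIdx
  simp only [Measure.smul_apply, Measure.finsetSum_apply, smul_eq_mul]
  calc _ ≤ (10 : ℝ≥0∞)⁻¹ ^ I.card * (((p.choose I.card : ℕ) : ℝ≥0∞)⁻¹ * uniformIdx I A) := by
        rw [ENNReal.mul_inv (Or.inl (by simp)) (Or.inl (by simp)), mul_pow, mul_assoc]
        gcongr
        rw [← ENNReal.inv_pow, ENNReal.inv_le_inv]
        exact_mod_cast Nat.choose_le_pow p I.card
    _ ≤ (10 : ℝ≥0∞)⁻¹ ^ I.card * ∑ J ∈ Finset.powersetCard I.card (Finset.univ : Finset (Fin p)),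
          ((p.choose I.card : ℕ) : ℝ≥0∞)⁻¹ * uniformIdx J A := by
        gcongr
        exact Finset.single_le_sum (f := fun J => ((p.choose I.card : ℕ) : ℝ≥0∞)⁻¹ * uniformIdx J A)
          (fun _ _ => zero_le) (Finset.mem_powersetCard.2 ⟨Finset.subset_univ _, rfl⟩)
    _ ≤ ∑ i ∈ Finset.Icc 1 p, (10 : ℝ≥0∞)⁻¹ ^ i *
          ∑ J ∈ Finset.powersetCard i (Finset.univ : Finset (Fin p)),
          ((p.choose i : ℕ) : ℝ≥0∞)⁻¹ * uniformIdx J A :=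
        Finset.single_le_sum (f := fun i => (10 : ℝ≥0∞)⁻¹ ^ i *
          ∑ J ∈ Finset.powersetCard i (Finset.univ : Finset (Fin p)),
          ((p.choose i : ℕ) : ℝ≥0∞)⁻¹ * uniformIdx J A) (fun _ _ => zero_le) hmem
    _ ≤ _ := le_mul_of_one_le_left' (one_le_inv_sum_tenth_pow p)

/-! ### Small balls under the prior on link functions -/

section Link

variable {ℓ : ℝ} (φ : Dictionary ℓ) {M : ℕ}

theorem Dictionary.norm_atom_le (i : ℕ) : ‖φ.atom i‖ ≤ 1 := by
  rw [ContinuousMap.norm_le _ zero_le_one]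
  exact fun t => φ.abs_le_one (i + 1) (Nat.le_add_left 1 i) t t.2

theorem sum_abs_le_weighted (β : Fin M → ℝ) :
    ∑ i, |β i| ≤ ∑ i : Fin M, ((i : ℕ) + 1 : ℝ) * |β i| :=
  Finset.sum_le_sum fun i _ => le_mul_of_one_le_left (abs_nonneg _) (by simp)

theorem Dictionary.norm_comb_le (β : Fin M → ℝ) :
    ‖φ.comb M β‖ ≤ ∑ i : Fin M, ((i : ℕ) + 1 : ℝ) * |β i| := by
  refine ((norm_sum_le _ _).trans (Finset.sum_le_sum fun i _ => ?_)).trans (sum_abs_le_weighted β)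
  rw [norm_smul, Real.norm_eq_abs]
  exact mul_le_of_le_one_right (abs_nonneg _) (φ.norm_atom_le i)

theorem Dictionary.comb_sub (β γ : Fin M → ℝ) :
    φ.comb M (β - γ) = φ.comb M β - φ.comb M γ := by
  simp [Dictionary.comb, sub_smul, Finset.sum_sub_distrib]

theorem Dictionary.measurable_comb : Measurable (φ.comb M) :=
  (continuous_finsetSum _ fun i _ => (continuous_apply i).smul continuous_const).measurable

theorem Dictionary.abs_atom_sub_le (i : ℕ) (s t : Set.Icc (-1 : ℝ) 1) :
    |φ.atom i s - φ.atom i t| ≤ ℓ * ((i : ℝ) + 1) * |(s : ℝ) - t| := by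
  have h := Convex.norm_image_sub_le_of_norm_derivWithin_le
    (φ.differentiableOn (i + 1) (Nat.le_add_left 1 i))
    (φ.abs_deriv_le (i + 1) (Nat.le_add_left 1 i)) (convex_Icc (-1 : ℝ) 1) t.2 s.2
  rw [Nat.cast_add_one] at h
  exact h

theorem Dictionary.abs_linkFun_comb_sub_le (hℓ : 0 ≤ ℓ) (β : Fin M → ℝ) (s t : ℝ) :
    |linkFun (φ.comb M β) s - linkFun (φ.comb M β) t|
      ≤ ℓ * (∑ i : Fin M, ((i : ℕ) + 1 : ℝ) * |β i|) * |s - t| := by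
  have hle : (-1 : ℝ) ≤ 1 := by norm_num
  have hproj : |(Set.projIcc (-1 : ℝ) 1 hle s : ℝ) - Set.projIcc (-1 : ℝ) 1 hle t| ≤ |s - t| := by
    have h := (LipschitzWith.projIcc hle).dist_le_mul s t
    simpa [Subtype.dist_eq, Real.dist_eq] using h
  simp only [linkFun, Set.IccExtend, Function.comp_apply]
  generalize Set.projIcc (-1 : ℝ) 1 hle s = s' at *
  generalize Set.projIcc (-1 : ℝ) 1 hle t = t' at *
  have hexp : φ.comb M β s' - φ.comb M β t' = ∑ i : Fin M, β i * (φ.atom i s' - φ.atom i t') := by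
    simp [Dictionary.comb, mul_sub, Finset.sum_sub_distrib]
  rw [hexp, Finset.mul_sum, Finset.sum_mul]
  refine (Finset.abs_sum_le_sum_abs _ _).trans (Finset.sum_le_sum fun i _ => ?_)
  rw [abs_mul]
  calc |β i| * |φ.atom i s' - φ.atom i t'|
      ≤ |β i| * (ℓ * ((i : ℕ) + 1) * |s - t|) := by
        gcongr
        exact (φ.abs_atom_sub_le i s' t').trans (by gcongr)
    _ = _ := by ring

theorem measurableSet_coeffSet (M : ℕ) (Λ : ℝ) : MeasurableSet (coeffSet M Λ) := by
  have h1 : MeasurableSet {β : Fin M → ℝ | ∑ i : Fin M, ((i : ℕ) + 1 : ℝ) * |β i| ≤ Λ} :=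
    measurableSet_le (by fun_prop) measurable_const
  have h2 : MeasurableSet {β : Fin M → ℝ | ∀ i : Fin M, (i : ℕ) + 1 = M → β i ≠ 0} := by
    simp only [Set.ofPred_forall]
    exact MeasurableSet.iInter fun i => MeasurableSet.iInter fun _ =>
      (measurable_pi_apply i (measurableSet_singleton 0)).compl
  exact h1.inter h2

theorem volume_coeffSet_ne_top (M : ℕ) (Λ : ℝ) : volume (coeffSet M Λ) ≠ ∞ := by
  refine ne_top_of_le_ne_top (isCompact_Icc (a := fun _ : Fin M => -Λ)
    (b := fun _ : Fin M => Λ)).measure_lt_top.ne (measure_mono fun β hβ => ?_)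
  have h : ∀ i, |β i| ≤ Λ := fun i =>
    ((Finset.single_le_sum (f := fun i => |β i|) (fun _ _ => abs_nonneg _) (Finset.mem_univ i)).trans
      (sum_abs_le_weighted β)).trans hβ.1
  exact ⟨fun i => (abs_le.1 (h i)).1, fun i => (abs_le.1 (h i)).2⟩

theorem exists_mem_coeffSet (hM : 1 ≤ M) {Λ : ℝ} (hΛ : 0 < Λ) :
    ∃ β : Fin M → ℝ, ∑ i : Fin M, ((i : ℕ) + 1 : ℝ) * |β i| < Λ ∧
      ∀ i : Fin M, (i : ℕ) + 1 = M → β i ≠ 0 := by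
  have hM0 : (0 : ℝ) < M := by exact_mod_cast hM
  let last : Fin M := ⟨M - 1, by omega⟩
  refine ⟨Pi.single last (Λ / (2 * M)), ?_, fun i hi => ?_⟩
  · rw [Finset.sum_eq_single last (fun i _ hi => by simp [hi]) (by simp)]
    have hl : ((last : ℕ) : ℝ) + 1 = M := by
      have : (last : ℕ) + 1 = M := Nat.sub_add_cancel hM
      exact_mod_cast this
    rw [hl, Pi.single_eq_same, abs_of_pos (by positivity)]
    have : (M : ℝ) * (Λ / (2 * M)) = Λ / 2 := by field_simp
    linarith
  · have : i = last := Fin.ext (by simp [last]; omega)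
    subst this
    rw [Pi.single_eq_same]
    positivity

theorem volume_coeffSet_ne_zero (hM : 1 ≤ M) {Λ : ℝ} (hΛ : 0 < Λ) : volume (coeffSet M Λ) ≠ 0 := by
  have h1 : IsOpen {β : Fin M → ℝ | ∑ i : Fin M, ((i : ℕ) + 1 : ℝ) * |β i| < Λ} :=
    isOpen_lt (by fun_prop) continuous_const
  have h2 : IsOpen {β : Fin M → ℝ | ∀ i : Fin M, (i : ℕ) + 1 = M → β i ≠ 0} := by
    simp only [Set.ofPred_forall]
    exact isOpen_iInter_of_finite fun i => isOpen_iInter_of_finite fun _ =>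
      isOpen_ne_fun (continuous_apply i) continuous_const
  refine (((h1.inter h2).measure_pos volume (exists_mem_coeffSet hM hΛ)).trans_le
    (measure_mono ?_)).ne'
  exact fun β hβ => ⟨le_of_lt hβ.1, hβ.2⟩

/-- The weighted `ℓ¹`-ball is convex, so the homothety of ratio `ε` centred at `β₀` maps it into
itself, close to `β₀`, and scales volume by `ε^M`. The weighted norm dominates the uniform norm of
the link. -/
theorem Dictionary.uniformLink_ball_ge (hM : 1 ≤ M) {Λ : ℝ} (hΛ : 0 < Λ) {β₀ : Fin M → ℝ}
    (hβ : ∑ i : Fin M, ((i : ℕ) + 1 : ℝ) * |β₀ i| ≤ Λ) {ε : ℝ} (h0 : 0 < ε) (h1 : ε ≤ 1) :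
    ENNReal.ofReal ε ^ M ≤
      φ.uniformLink M Λ {f | ‖f - φ.comb M β₀‖ ≤ 2 * Λ * ε} := by
  have hclosed : IsClosed {f : LinkSpace | ‖f - φ.comb M β₀‖ ≤ 2 * Λ * ε} :=
    isClosed_le (by fun_prop) continuous_const
  have hfin := volume_coeffSet_ne_top M Λ
  have hpos := volume_coeffSet_ne_zero hM hΛ
  let last : Fin M := ⟨M - 1, by omega⟩
  rw [Dictionary.uniformLink, Measure.map_apply φ.measurable_comb hclosed.measurableSet,
    cond_apply (measurableSet_coeffSet M Λ)]
  set N : (Fin M → ℝ) → ℝ := fun β => ∑ i : Fin M, ((i : ℕ) + 1 : ℝ) * |β i| with hN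
  -- Contraction may violate the condition on the last coefficient, but only on a null hyperplane.
  have hsub : AffineMap.homothety β₀ ε '' coeffSet M Λ \ {β | β last = 0} ⊆
      coeffSet M Λ ∩ φ.comb M ⁻¹' {f | ‖f - φ.comb M β₀‖ ≤ 2 * Λ * ε} := by
    rintro _ ⟨⟨β, hβ', rfl⟩, hlast⟩
    have hcoord : ∀ i, AffineMap.homothety β₀ ε β i = ε * (β i - β₀ i) + β₀ i := fun i => by
      simp [AffineMap.homothety_apply]
    refine ⟨⟨?_, fun i hi => ?_⟩, ?_⟩
    · calc ∑ i : Fin M, ((i : ℕ) + 1 : ℝ) * |AffineMap.homothety β₀ ε β i|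
          ≤ ∑ i : Fin M, ((i : ℕ) + 1 : ℝ) * (ε * |β i| + (1 - ε) * |β₀ i|) := by
            gcongr with i _
            rw [hcoord, show ε * (β i - β₀ i) + β₀ i = ε * β i + (1 - ε) * β₀ i by ring]
            refine (abs_add_le _ _).trans ?_
            rw [abs_mul, abs_mul, abs_of_pos h0, abs_of_nonneg (sub_nonneg.2 h1)]
        _ = ε * N β + (1 - ε) * N β₀ := by
            simp only [hN, mul_add, Finset.sum_add_distrib, Finset.mul_sum]
            congr 1 <;> exact Finset.sum_congr rfl fun i _ => by ring
        _ ≤ ε * Λ + (1 - ε) * Λ := by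
            have := sub_nonneg.2 h1
            gcongr
            exact hβ'.1
        _ = Λ := by ring
    · have : i = last := Fin.ext (by simp [last]; omega)
      rw [this]
      exact hlast
    · change ‖φ.comb M (AffineMap.homothety β₀ ε β) - φ.comb M β₀‖ ≤ 2 * Λ * ε
      rw [← φ.comb_sub]
      refine (φ.norm_comb_le _).trans ?_
      calc ∑ i : Fin M, ((i : ℕ) + 1 : ℝ) * |(AffineMap.homothety β₀ ε β - β₀) i|
          ≤ ∑ i : Fin M, ((i : ℕ) + 1 : ℝ) * (ε * (|β i| + |β₀ i|)) := by
            gcongr with i _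
            rw [Pi.sub_apply, hcoord, add_sub_cancel_right, abs_mul, abs_of_pos h0]
            gcongr
            exact abs_sub _ _
        _ = ε * (N β + N β₀) := by
            simp only [hN, mul_add, Finset.sum_add_distrib, Finset.mul_sum]
            congr 1 <;> exact Finset.sum_congr rfl fun i _ => by ring
        _ ≤ ε * (Λ + Λ) := by gcongr; exact hβ'.1
        _ = 2 * Λ * ε := by ring
  have hnull : volume {β : Fin M → ℝ | β last = 0} = 0 :=
    Measure.pi_hyperplane (fun _ => volume) last 0
  have hvol : ENNReal.ofReal ε ^ M * volume (coeffSet M Λ) ≤ volume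
      (coeffSet M Λ ∩ φ.comb M ⁻¹' {f | ‖f - φ.comb M β₀‖ ≤ 2 * Λ * ε}) := by
    refine le_trans (le_of_eq ?_) (measure_mono hsub)
    rw [measure_sdiff_null hnull, Measure.addHaar_image_homothety, Module.finrank_fin_fun,
      abs_of_pos (by positivity), ENNReal.ofReal_pow h0.le]
  calc ENNReal.ofReal ε ^ M
      = (volume (coeffSet M Λ))⁻¹ * (ENNReal.ofReal ε ^ M * volume (coeffSet M Λ)) := by
        rw [mul_left_comm, ENNReal.inv_mul_cancel hpos hfin, mul_one]
    _ ≤ _ := by gcongr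

theorem Dictionary.ae_uniformLink (M : ℕ) (Λ : ℝ) :
    ∀ᵐ f ∂(φ.uniformLink M Λ), ‖f‖ ≤ Λ := by
  have hclosed : IsClosed {f : LinkSpace | ‖f‖ ≤ Λ} := isClosed_le (by fun_prop) continuous_const
  rw [Dictionary.uniformLink, ae_map_iff φ.measurable_comb.aemeasurable hclosed.measurableSet]
  exact ae_cond_of_forall_mem (measurableSet_coeffSet M Λ) fun β hβ =>
    (φ.norm_comb_le β).trans hβ.1

theorem Dictionary.uniformLink_univ_le (M : ℕ) (Λ : ℝ) : φ.uniformLink M Λ Set.univ ≤ 1 := by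
  rw [Dictionary.uniformLink, Measure.map_apply φ.measurable_comb MeasurableSet.univ]
  exact prob_le_one

theorem Dictionary.priorLink_univ_le (n : ℕ) (C : ℝ) : φ.priorLink n C Set.univ ≤ 1 := by
  unfold Dictionary.priorLink
  simp only [Measure.smul_apply, Measure.finsetSum_apply, smul_eq_mul]
  exact inv_sum_tenth_pow_mul_le_one (fun M => φ.uniformLink_univ_le M (C + 1)) n

theorem Dictionary.ae_priorLink (n : ℕ) (C : ℝ) : ∀ᵐ f ∂(φ.priorLink n C), ‖f‖ ≤ C + 1 := by
  unfold Dictionary.priorLink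
  refine Measure.ae_smul_measure ?_ _
  rw [ae_iff, Measure.finsetSum_apply]
  refine Finset.sum_eq_zero fun M _ => ?_
  rw [Measure.smul_apply, ae_iff.1 (φ.ae_uniformLink M (C + 1)), smul_zero]

theorem Dictionary.priorLink_ge {n : ℕ} (hM : 1 ≤ M) (hMn : M ≤ n) (C : ℝ) (A : Set LinkSpace) :
    (10 : ℝ≥0∞)⁻¹ ^ M * φ.uniformLink M (C + 1) A ≤ φ.priorLink n C A := by
  unfold Dictionary.priorLink
  simp only [Measure.smul_apply, Measure.finsetSum_apply, smul_eq_mul]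
  exact (Finset.single_le_sum (f := fun M => (10 : ℝ≥0∞)⁻¹ ^ M * φ.uniformLink M (C + 1) A)
    (fun _ _ => zero_le) (Finset.mem_Icc.2 ⟨hM, hMn⟩)).trans
    (le_mul_of_one_le_left' (one_le_inv_sum_tenth_pow n))

end Link

/-! ### The prior -/

instance isFiniteMeasure_priorIdx (p : ℕ) : IsFiniteMeasure (priorIdx p) :=
  ⟨(priorIdx_univ_le p).trans_lt ENNReal.one_lt_top⟩

section Prior

variable {ℓ : ℝ} (φ : Dictionary ℓ)

instance isFiniteMeasure_priorLink (n : ℕ) (C : ℝ) : IsFiniteMeasure (φ.priorLink n C) :=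
  ⟨(φ.priorLink_univ_le n C).trans_lt ENNReal.one_lt_top⟩

instance isFiniteMeasure_prior (p n : ℕ) (C : ℝ) : IsFiniteMeasure (φ.prior p n C) := by
  unfold Dictionary.prior; infer_instance

theorem Dictionary.prior_univ_le (p n : ℕ) (C : ℝ) : φ.prior p n C Set.univ ≤ 1 := by
  rw [Dictionary.prior, ← Set.univ_prod_univ, Measure.prod_prod]
  exact mul_le_one' (priorIdx_univ_le p) (φ.priorLink_univ_le n C)

theorem Dictionary.ae_prior (p n : ℕ) (C : ℝ) : ∀ᵐ q ∂(φ.prior p n C), ‖q.2‖ ≤ C + 1 :=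
  Measure.quasiMeasurePreserving_snd.ae (φ.ae_priorLink n C)

/-- The set of predictors that are `1/n`-close to the predictor with index `θ₀` and link `f₀`. -/
def predictorBall {p : ℕ} (n : ℕ) (C : ℝ) (θ₀ : Idx p) (f₀ : LinkSpace) : Set (Idx p × LinkSpace) :=
  {θ : Idx p | ∑ j, |θ j - θ₀ j| ≤ 2 * (1 / (n : ℝ))} ×ˢ
    {f | ‖f - f₀‖ ≤ 2 * (C + 1) * (1 / (n : ℝ))}

theorem measurableSet_predictorBall {p : ℕ} (n : ℕ) (C : ℝ) (θ₀ : Idx p) (f₀ : LinkSpace) :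
    MeasurableSet (predictorBall n C θ₀ f₀) := by
  have h1 : IsClosed {θ : Idx p | ∑ j, |θ j - θ₀ j| ≤ 2 * (1 / (n : ℝ))} :=
    isClosed_le (by fun_prop) continuous_const
  have h2 : IsClosed {f : LinkSpace | ‖f - f₀‖ ≤ 2 * (C + 1) * (1 / (n : ℝ))} :=
    isClosed_le (by fun_prop) continuous_const
  exact h1.measurableSet.prod h2.measurableSet

/-- Both small-ball bounds at `ε = 1/n`: the factor `20 p n` combines the weight `10`, the bound
`p^|I|` for the binomial coefficient and the ratio `ε/2`; the factor `10 n` combines the weight `10`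
and `ε`. -/
theorem Dictionary.prior_predictorBall_ge {p n M : ℕ} {C : ℝ} (hC : 0 ≤ C) (hM : 1 ≤ M) (hMn : M ≤ n)
    {I : Finset (Fin p)} (hI : I.Nonempty) {θ₀ : Idx p} (hθ : θ₀ ∈ sphereOn I) {β₀ : Fin M → ℝ}
    (hβ : β₀ ∈ coeffSet M C) :
    ENNReal.ofReal ((1 / (20 * (p * n))) ^ I.card * (1 / (10 * n)) ^ M) ≤
      φ.prior p n C (predictorBall n C θ₀ (φ.comb M β₀)) := by
  have hn : (1 : ℝ) ≤ n := by exact_mod_cast hM.trans hMn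
  have hn0 : (0 : ℝ) < n := by linarith
  have hε1 : 1 / (n : ℝ) ≤ 1 := by rw [div_le_one hn0]; exact hn
  have hp0 : (0 : ℝ) < p := by
    obtain ⟨j, _⟩ := hI
    exact_mod_cast j.pos
  rw [Dictionary.prior, predictorBall, Measure.prod_prod, ENNReal.ofReal_mul (by positivity)]
  have e10 : (10 : ℝ≥0∞)⁻¹ = ENNReal.ofReal (1 / 10) := by
    rw [one_div, ENNReal.ofReal_inv_of_pos (by norm_num), ENNReal.ofReal_ofNat]
  have e10p : ((10 : ℝ≥0∞) * p)⁻¹ = ENNReal.ofReal (1 / (10 * p)) := by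
    rw [one_div, ENNReal.ofReal_inv_of_pos (by positivity), ENNReal.ofReal_mul (by norm_num),
      ENNReal.ofReal_ofNat, ENNReal.ofReal_natCast]
  refine mul_le_mul' ?_ ?_
  · refine le_trans (le_of_eq ?_) ((mul_le_mul_right
      (uniformIdx_ball_ge hI hθ (show 0 < 1 / (n : ℝ) by positivity) hε1) _).trans
        (priorIdx_ge hI _))
    rw [e10p, ← mul_pow, ← ENNReal.ofReal_mul (by positivity), ← ENNReal.ofReal_pow (by positivity)]
    congr 2
    field_simp
    norm_num
  · refine le_trans (le_of_eq ?_) ((mul_le_mul_right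
      (φ.uniformLink_ball_ge hM (show 0 < C + 1 by linarith) (hβ.1.trans (by linarith))
        (show 0 < 1 / (n : ℝ) by positivity) hε1) _).trans (φ.priorLink_ge hM hMn C _))
    rw [e10, ← mul_pow, ← ENNReal.ofReal_mul (by positivity), ← ENNReal.ofReal_pow (by positivity)]
    congr 2
    field_simp

end Prior

/-! ### Concentration of Gibbs measures -/

/-- The Cauchy-Schwarz inequality for `exp (-h)` and `exp h`. -/
theorem sq_measure_univ_le_lintegral_exp_mul {α : Type*} [MeasurableSpace α] (μ : Measure α)
    {h : α → ℝ} (hh : Measurable h) :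
    μ Set.univ ^ 2 ≤ (∫⁻ x, ENNReal.ofReal (Real.exp (-h x)) ∂μ) *
      ∫⁻ x, ENNReal.ofReal (Real.exp (h x)) ∂μ := by
  have hCS := ENNReal.lintegral_mul_le_Lp_mul_Lq μ (p := 2) (q := 2) Real.HolderConjugate.two_two
    (f := fun x => ENNReal.ofReal (Real.exp (-h x / 2)))
    (g := fun x => ENNReal.ofReal (Real.exp (h x / 2))) (by fun_prop) (by fun_prop)
  have h1 : ∀ x, ENNReal.ofReal (Real.exp (-h x / 2)) * ENNReal.ofReal (Real.exp (h x / 2)) = 1 := by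
    intro x
    rw [← ENNReal.ofReal_mul (Real.exp_pos _).le, ← Real.exp_add]
    simp [neg_div]
  have h2 : ∀ y : ℝ, ENNReal.ofReal (Real.exp (y / 2)) ^ (2 : ℝ) = ENNReal.ofReal (Real.exp y) := by
    intro y
    rw [ENNReal.rpow_two, ← ENNReal.ofReal_pow (Real.exp_pos _).le, ← Real.exp_nat_mul]
    congr 2; push_cast; ring
  simp only [Pi.mul_apply, h1, h2, lintegral_const, one_mul] at hCS
  calc μ Set.univ ^ 2 ≤ _ := pow_le_pow_left' hCS 2
    _ = _ := by
      rw [mul_pow, ← ENNReal.rpow_two, ← ENNReal.rpow_two, ← ENNReal.rpow_mul, ← ENNReal.rpow_mul]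
      norm_num

/-- Replaces the reciprocal of a random normalizer by an integral whose expectation can be computed
by Fubini. -/
theorem inv_lintegral_exp_neg_le {α : Type*} [MeasurableSpace α] (μ : Measure α)
    {h : α → ℝ} (hh : Measurable h) {A : Set α} (hA0 : μ A ≠ 0) (hAt : μ A ≠ ∞)
    (hZ : ∫⁻ x, ENNReal.ofReal (Real.exp (-h x)) ∂μ ≠ ∞) :
    (∫⁻ x, ENNReal.ofReal (Real.exp (-h x)) ∂μ)⁻¹ ≤
      (μ A ^ 2)⁻¹ * ∫⁻ x in A, ENNReal.ofReal (Real.exp (h x)) ∂μ := by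
  have hCS := sq_measure_univ_le_lintegral_exp_mul (μ.restrict A) hh
  rw [Measure.restrict_apply_univ] at hCS
  set Z := ∫⁻ x, ENNReal.ofReal (Real.exp (-h x)) ∂μ
  set V := ∫⁻ x in A, ENNReal.ofReal (Real.exp (h x)) ∂μ
  have hle : μ A ^ 2 ≤ Z * V := hCS.trans (by gcongr; exact setLIntegral_le_lintegral _ _)
  have hsq0 : μ A ^ 2 ≠ 0 := pow_ne_zero 2 hA0
  have hsqt : μ A ^ 2 ≠ ∞ := ENNReal.pow_ne_top hAt
  have hZ0 : Z ≠ 0 := fun h0 => hsq0 (le_antisymm (by simpa [h0] using hle) zero_le)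
  calc Z⁻¹ = (μ A ^ 2)⁻¹ * (Z⁻¹ * μ A ^ 2) := by
        rw [mul_left_comm, ENNReal.inv_mul_cancel hsq0 hsqt, mul_one]
    _ ≤ (μ A ^ 2)⁻¹ * (Z⁻¹ * (Z * V)) := by gcongr
    _ = (μ A ^ 2)⁻¹ * V := by rw [← mul_assoc Z⁻¹, ENNReal.inv_mul_cancel hZ0 hZ, one_mul]

/-- A Chernoff bound for the numerator, using `1 ≤ exp(G - κ)` on `B`, combined with the bound on
the reciprocal normalizer. -/
theorem tilted_neg_le {α : Type*} [MeasurableSpace α] (μ : Measure α) [IsFiniteMeasure μ]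
    {h G : α → ℝ} (hh : Measurable h) (hG : Measurable G)
    (hint : Integrable (fun x => Real.exp (-h x)) μ) {A : Set α} (hA0 : μ A ≠ 0) {B : Set α} {κ : ℝ}
    (hB : ∀ x ∈ B, κ ≤ G x) :
    μ.tilted (fun x => -h x) B ≤ ENNReal.ofReal (Real.exp (-κ)) *
      (∫⁻ x, ENNReal.ofReal (Real.exp (G x - h x)) ∂μ) *
        ((μ A ^ 2)⁻¹ * ∫⁻ x in A, ENNReal.ofReal (Real.exp (h x)) ∂μ) := by
  have hB' : MeasurableSet {x | κ ≤ G x} := measurableSet_le measurable_const hG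
  have hZ : ENNReal.ofReal (∫ x, Real.exp (-h x) ∂μ) = ∫⁻ x, ENNReal.ofReal (Real.exp (-h x)) ∂μ :=
    ofReal_integral_eq_lintegral_ofReal hint
      (Filter.Eventually.of_forall fun x => (Real.exp_pos _).le)
  have hne : NeZero μ := ⟨fun h0 => hA0 (by simp [h0])⟩
  have hZpos : 0 < ∫ x, Real.exp (-h x) ∂μ := integral_exp_pos hint
  calc μ.tilted (fun x => -h x) B ≤ μ.tilted (fun x => -h x) {x | κ ≤ G x} :=
        measure_mono fun x hx => hB x hx
    _ = ∫⁻ x in {x | κ ≤ G x},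
          ENNReal.ofReal (Real.exp (-h x) / ∫ y, Real.exp (-h y) ∂μ) ∂μ := tilted_apply _ _ _
    _ ≤ ∫⁻ x in {x | κ ≤ G x}, ENNReal.ofReal (Real.exp (-κ)) *
          ENNReal.ofReal (Real.exp (G x - h x)) *
            (∫⁻ x, ENNReal.ofReal (Real.exp (-h x)) ∂μ)⁻¹ ∂μ := by
        refine setLIntegral_mono' hB' fun x hx => ?_
        rw [ENNReal.ofReal_div_of_pos hZpos, hZ, div_eq_mul_inv]
        gcongr
        rw [← ENNReal.ofReal_mul (Real.exp_pos _).le, ← Real.exp_add]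
        refine ENNReal.ofReal_le_ofReal (Real.exp_le_exp.2 ?_)
        have : κ ≤ G x := hx
        linarith
    _ ≤ ∫⁻ x, ENNReal.ofReal (Real.exp (-κ)) *
          ENNReal.ofReal (Real.exp (G x - h x)) *
            (∫⁻ x, ENNReal.ofReal (Real.exp (-h x)) ∂μ)⁻¹ ∂μ := setLIntegral_le_lintegral _ _
    _ = ENNReal.ofReal (Real.exp (-κ)) * (∫⁻ x, ENNReal.ofReal (Real.exp (G x - h x)) ∂μ) *
          (∫⁻ x, ENNReal.ofReal (Real.exp (-h x)) ∂μ)⁻¹ := by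
        rw [lintegral_mul_const _ (by fun_prop), lintegral_const_mul _ (by fun_prop)]
    _ ≤ _ := by
        gcongr
        refine inv_lintegral_exp_neg_le μ hh hA0 (measure_ne_top _ _) ?_
        rw [← hZ]
        exact ENNReal.ofReal_ne_top

/-- As `t ≤ 1`, `t² ≤ t ≤ K U V`, and `√(δU · KV/δ)` is at most the arithmetic mean of its two
factors. This lets the expectations of the dependent variables `U` and `V` be taken separately. -/
theorem le_half_add_of_le_mul {t U V : ℝ≥0∞} {K δ : ℝ} (hK : 0 < K) (hδ : 0 < δ) (h1 : t ≤ 1)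
    (h2 : t ≤ ENNReal.ofReal K * U * V) :
    t ≤ ENNReal.ofReal (δ / 2) * U + ENNReal.ofReal (K / (2 * δ)) * V := by
  by_cases hU : U = ∞
  · rw [hU, ENNReal.mul_top (by simpa using half_pos hδ), top_add]; exact le_top
  by_cases hV : V = ∞
  · rw [hV, ENNReal.mul_top (by simpa using show 0 < K / (2 * δ) by positivity), add_top]
    exact le_top
  lift t to NNReal using ne_top_of_le_ne_top ENNReal.one_ne_top h1
  have hu : U = ENNReal.ofReal U.toReal := (ENNReal.ofReal_toReal hU).symm
  have hv : V = ENNReal.ofReal V.toReal := (ENNReal.ofReal_toReal hV).symm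
  have hu0 : 0 ≤ U.toReal := ENNReal.toReal_nonneg
  have hv0 : 0 ≤ V.toReal := ENNReal.toReal_nonneg
  generalize U.toReal = u at *
  generalize V.toReal = v at *
  subst hu hv
  rw [← ENNReal.ofReal_coe_nnreal (p := t)] at *
  rw [← ENNReal.ofReal_mul hK.le, ← ENNReal.ofReal_mul (by positivity),
    ENNReal.ofReal_le_ofReal_iff (by positivity)] at h2
  rw [ENNReal.ofReal_le_one] at h1
  rw [← ENNReal.ofReal_mul (by positivity), ← ENNReal.ofReal_mul (by positivity),
    ← ENNReal.ofReal_add (by positivity) (by positivity)]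
  refine ENNReal.ofReal_le_ofReal ?_
  have ht : (0 : ℝ) ≤ t := t.2
  generalize (t : ℝ) = τ at *
  refine le_of_sq_le_sq ?_ (by positivity)
  have hd : δ / 2 * u * (K / (2 * δ) * v) = K * u * v / 4 := by field_simp; ring
  nlinarith [sq_nonneg (δ / 2 * u - K / (2 * δ) * v)]

theorem lintegral_pi_prod_eq {Ω : Type*} [MeasurableSpace Ω] (P : Measure Ω) [IsProbabilityMeasure P]
    (n : ℕ) {f : Ω → ℝ≥0∞} (hf : Measurable f) :
    ∫⁻ D : Fin n → Ω, ∏ i, f (D i) ∂(Measure.pi fun _ => P) = (∫⁻ z, f z ∂P) ^ n := by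
  have hind : iIndepFun (fun (i : Fin n) (D : Fin n → Ω) => f (D i)) (Measure.pi fun _ => P) :=
    iIndepFun_pi fun _ => hf.aemeasurable
  rw [lintegral_prod_eq_prod_lintegral_of_indepFun Finset.univ _ hind
    fun i => hf.comp (measurable_pi_apply i)]
  have h : ∀ i : Fin n, ∫⁻ D : Fin n → Ω, f (D i) ∂(Measure.pi fun _ => P) = ∫⁻ z, f z ∂P :=
    fun i => (measurePreserving_eval (fun _ : Fin n => P) i).lintegral_comp hf
  simp [h]

/-! ### Exponential moments over the sample and posterior concentration. -/

section Sample

variable {p n : ℕ} {P : Measure (Obs p)} {θs : Idx p} {fs : ℝ → ℝ} {L C σ ℓ : ℝ}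

/-- The total empirical excess loss over the sample. -/
noncomputable def totalExcess (θs : Idx p) (fs : ℝ → ℝ) (D : Fin n → Obs p) (q : Idx p × LinkSpace) : ℝ :=
  ∑ i, excessLoss θs fs q (D i)

theorem measurable_excessLoss (hfs : Measurable fs) :
    Measurable fun r : (Idx p × LinkSpace) × Obs p => excessLoss θs fs r.1 r.2 := by
  have h1 : Measurable fun r : (Idx p × LinkSpace) × Obs p => gap θs fs r.1 r.2.1 :=
    (measurable_gap hfs).comp (measurable_fst.prodMk (measurable_fst.comp measurable_snd))
  have h2 : Measurable fun r : (Idx p × LinkSpace) × Obs p => noise θs fs r.2 :=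
    (measurable_noise θs hfs).comp measurable_snd
  exact (h1.pow_const 2).add ((h1.mul h2).const_mul 2)

theorem measurable_totalExcess (hfs : Measurable fs) :
    Measurable fun r : (Fin n → Obs p) × (Idx p × LinkSpace) => totalExcess θs fs r.1 r.2 := by
  unfold totalExcess
  refine Finset.measurable_fun_sum _ fun i _ => ?_
  have h1 : Measurable fun r : (Fin n → Obs p) × (Idx p × LinkSpace) => (r.2, r.1 i) :=
    measurable_snd.prodMk ((measurable_pi_apply i).comp measurable_fst)
  have h2 := (measurable_excessLoss (p := p) (θs := θs) hfs).comp h1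
  exact h2

theorem measurable_totalExcess_right (hfs : Measurable fs) (D : Fin n → Obs p) :
    Measurable (totalExcess θs fs D) := by
  have h1 : Measurable fun q : Idx p × LinkSpace => (D, q) := measurable_prodMk_left
  have h2 := (measurable_totalExcess (p := p) (θs := θs) hfs).comp h1
  exact h2

theorem empRisk_eq (D : Fin n → Obs p) (q : Idx p × LinkSpace) :
    empRisk D q.1 (linkFun q.2) =
      (1 / (n : ℝ)) * totalExcess θs fs D q + empRisk D θs fs := by
  simp only [empRisk, totalExcess, excessLoss_eq, Finset.sum_sub_distrib]
  ring

theorem tilted_add_const {α : Type*} [MeasurableSpace α] (μ : Measure α) (f : α → ℝ) (c : ℝ) :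
    μ.tilted (fun x => f x + c) = μ.tilted f := by
  simp_rw [Measure.tilted, Real.exp_add, integral_mul_const]
  congr 1 with x
  rw [mul_div_mul_right _ _ (Real.exp_pos c).ne']

/-- The empirical risk of the true regression function does not depend on `q`, so it cancels in the
Gibbs density. -/
theorem Dictionary.gibbs_eq_tilted (φ : Dictionary ℓ) (hn : 1 ≤ n) (θs : Idx p) (fs : ℝ → ℝ)
    (D : Fin n → Obs p) : φ.gibbs C (invTemp n L C σ) D =
      (φ.prior p n C).tilted (fun q => -(unitTemp L C σ * totalExcess θs fs D q)) := by
  have hn0 : (n : ℝ) ≠ 0 := by positivity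
  rw [Dictionary.gibbs, ← tilted_add_const _ (fun q => -(unitTemp L C σ * totalExcess θs fs D q))
    (-invTemp n L C σ * empRisk D θs fs)]
  congr 1 with q
  rw [empRisk_eq (θs := θs) (fs := fs), invTemp_eq]
  field_simp
  ring

theorem integrable_exp_neg_totalExcess (φ : Dictionary ℓ) (hfs : Measurable fs) {s : ℝ} (hs : 0 ≤ s)
    (D : Fin n → Obs p) :
    Integrable (fun q => Real.exp (-(s * totalExcess θs fs D q))) (φ.prior p n C) := by
  refine Integrable.of_bound (C := Real.exp (s * ∑ i, ((D i).2 - fs (dot θs (D i).1)) ^ 2)) ?_ ?_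
  · have := measurable_totalExcess_right (θs := θs) hfs D
    exact (by fun_prop : Measurable fun q =>
      Real.exp (-(s * totalExcess θs fs D q))).aestronglyMeasurable
  · refine Filter.Eventually.of_forall fun q => ?_
    rw [Real.norm_of_nonneg (Real.exp_pos _).le, Real.exp_le_exp, ← mul_neg]
    refine mul_le_mul_of_nonneg_left ?_ hs
    rw [totalExcess, ← Finset.sum_neg_distrib]
    refine Finset.sum_le_sum fun i _ => ?_
    rw [excessLoss_eq]
    linarith [sq_nonneg ((D i).2 - linkFun q.2 (dot q.1 (D i).1))]

/-- The squared `L²(P)` distance of a predictor to the regression function. -/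
noncomputable def sqDist (P : Measure (Obs p)) (θs : Idx p) (fs : ℝ → ℝ) (q : Idx p × LinkSpace) : ℝ :=
  ∫ z, gap θs fs q z.1 ^ 2 ∂P

theorem sqDist_nonneg (q : Idx p × LinkSpace) : 0 ≤ sqDist P θs fs q :=
  integral_nonneg fun _ => sq_nonneg _

theorem measurable_sqDist [SFinite P] (hfs : Measurable fs) : Measurable (sqDist P θs fs) := by
  have h1 : Measurable fun r : (Idx p × LinkSpace) × Obs p => gap θs fs r.1 r.2.1 ^ 2 :=
    ((measurable_gap hfs).comp (measurable_fst.prodMk (measurable_fst.comp measurable_snd))).pow_const 2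
  exact (h1.stronglyMeasurable.integral_prod_right' (ν := P)).measurable

theorem lintegral_pi_exp_sum_le [IsProbabilityMeasure P] {f : Obs p → ℝ} (hf : Measurable f) {b : ℝ}
    (hb : ∫⁻ z, ENNReal.ofReal (Real.exp (f z)) ∂P ≤ ENNReal.ofReal (Real.exp b)) :
    ∫⁻ D : Fin n → Obs p, ENNReal.ofReal (Real.exp (∑ i, f (D i))) ∂(Measure.pi fun _ => P)
      ≤ ENNReal.ofReal (Real.exp (n * b)) := by
  simp_rw [Real.exp_sum, ENNReal.ofReal_prod_of_nonneg fun i _ => (Real.exp_pos _).le]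
  rw [lintegral_pi_prod_eq P n (f := fun z => ENNReal.ofReal (Real.exp (f z))) (by fun_prop),
    Real.exp_nat_mul, ENNReal.ofReal_pow (Real.exp_pos _).le]
  gcongr

theorem measurable_excessLoss_right (hfs : Measurable fs) (q : Idx p × LinkSpace) :
    Measurable (excessLoss θs fs q) := by
  have h1 : Measurable fun z : Obs p => (q, z) := measurable_prodMk_left
  have h2 := (measurable_excessLoss (p := p) (θs := θs) hfs).comp h1
  exact h2

/-- The prior does not depend on the data, so the integrals can be swapped. For fixed `q` the sample
factorizes, and the added term `n s D / 2` exactly compensates the one-observation bound. -/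
theorem lintegral_exp_neg_totalExcess_le (φ : Dictionary ℓ) (hM : IsSingleIndexModel P θs fs)
    (hN : AssumptionN P θs fs L σ) (hB : AssumptionB P fs C) (hL : 0 ≤ L) (hC : 0 ≤ C) :
    ∫⁻ D : Fin n → Obs p, ∫⁻ q, ENNReal.ofReal (Real.exp (n * unitTemp L C σ / 2 * sqDist P θs fs q
      - unitTemp L C σ * totalExcess θs fs D q)) ∂(φ.prior p n C) ∂(Measure.pi fun _ => P) ≤ 1 := by
  have := hM.isProbabilityMeasure
  have hm1 := measurable_totalExcess (n := n) (θs := θs) hM.measurable_link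
  have hm2 := measurable_sqDist (P := P) (θs := θs) hM.measurable_link
  have hpi : SigmaFinite (Measure.pi fun _ : Fin n => P) := inferInstance
  rw [lintegral_lintegral_swap (by fun_prop)]
  calc _ ≤ ∫⁻ _, 1 ∂(φ.prior p n C) := by
        refine lintegral_mono_ae ?_
        filter_upwards [φ.ae_prior p n C] with q hq
        have hm3 := measurable_excessLoss_right (θs := θs) hM.measurable_link q
        have h := lintegral_pi_exp_sum_le (n := n) (by fun_prop)
          (lintegral_exp_neg_excessLoss_le hM hN hB hL hC hq)
        have hm4 : Measurable fun D : Fin n → Obs p =>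
            ENNReal.ofReal (Real.exp (∑ i, -(unitTemp L C σ * excessLoss θs fs q (D i)))) := by
          fun_prop
        have hsplit : ∀ D : Fin n → Obs p, ENNReal.ofReal (Real.exp (n * unitTemp L C σ / 2 *
            sqDist P θs fs q - unitTemp L C σ * totalExcess θs fs D q)) =
            ENNReal.ofReal (Real.exp (n * unitTemp L C σ / 2 * sqDist P θs fs q)) *
            ENNReal.ofReal (Real.exp (∑ i, -(unitTemp L C σ * excessLoss θs fs q (D i)))) := by
          intro D
          rw [← ENNReal.ofReal_mul (Real.exp_pos _).le, ← Real.exp_add, totalExcess,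
            Finset.sum_neg_distrib, ← Finset.mul_sum, ← sub_eq_add_neg]
        simp_rw [hsplit]
        rw [lintegral_const_mul _ hm4]
        refine (mul_le_mul_right h _).trans (le_of_eq ?_)
        rw [← ENNReal.ofReal_mul (Real.exp_pos _).le, ← Real.exp_add, sqDist]
        have : ∀ d : ℝ, n * unitTemp L C σ / 2 * d + n * -(unitTemp L C σ * d / 2) = 0 :=
          fun d => by ring
        rw [this, Real.exp_zero, ENNReal.ofReal_one]
    _ ≤ 1 := by simpa using φ.prior_univ_le p n C

theorem setLIntegral_exp_totalExcess_le (φ : Dictionary ℓ) (hM : IsSingleIndexModel P θs fs)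
    (hN : AssumptionN P θs fs L σ) (hB : AssumptionB P fs C) (hL : 0 ≤ L) (hC : 0 ≤ C)
    {A : Set (Idx p × LinkSpace)} (hA : MeasurableSet A) {r : ℝ}
    (hr : ∀ q ∈ A, sqDist P θs fs q ≤ r) :
    ∫⁻ D : Fin n → Obs p, ∫⁻ q in A, ENNReal.ofReal (Real.exp
      (unitTemp L C σ * totalExcess θs fs D q)) ∂(φ.prior p n C) ∂(Measure.pi fun _ => P)
      ≤ ENNReal.ofReal (Real.exp (3 / 2 * (n * unitTemp L C σ * r))) * φ.prior p n C A := by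
  have := hM.isProbabilityMeasure
  have hm1 := measurable_totalExcess (n := n) (θs := θs) hM.measurable_link
  have hpi : SigmaFinite (Measure.pi fun _ : Fin n => P) := inferInstance
  rw [lintegral_lintegral_swap (by fun_prop)]
  calc _ ≤ ∫⁻ _ in A, ENNReal.ofReal (Real.exp (3 / 2 * (n * unitTemp L C σ * r)))
        ∂(φ.prior p n C) := by
        refine lintegral_mono_ae ?_
        filter_upwards [ae_restrict_of_ae (φ.ae_prior p n C), ae_restrict_mem hA] with q hq hqA
        have hm3 := measurable_excessLoss_right (θs := θs) hM.measurable_link q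
        have h := lintegral_pi_exp_sum_le (n := n) (by fun_prop)
          (lintegral_exp_excessLoss_le hM hN hB hL hC hq)
        simp_rw [totalExcess, Finset.mul_sum]
        refine h.trans (ENNReal.ofReal_le_ofReal (Real.exp_le_exp.2 ?_))
        have hs := unitTemp_pos (L := L) (σ := σ) hC
        calc (n : ℝ) * (3 / 2 * (unitTemp L C σ * sqDist P θs fs q))
            = 3 / 2 * (n * unitTemp L C σ * sqDist P θs fs q) := by ring
          _ ≤ _ := by gcongr; exact hr q hqA
    _ = _ := by simp

/-- If the excess risk is at most `r` on a set `A` whose prior mass is not too small, then the Gibbs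
posterior puts, in expectation, mass at most `δ` on predictors with large excess risk. -/
theorem Dictionary.gibbs_concentration (φ : Dictionary ℓ) (hM : IsSingleIndexModel P θs fs)
    (hN : AssumptionN P θs fs L σ) (hB : AssumptionB P fs C) (hL : 0 ≤ L) (hC : 0 ≤ C) (hn : 1 ≤ n)
    {A : Set (Idx p × LinkSpace)} (hA : MeasurableSet A) {r ρ a δ : ℝ}
    (hr : ∀ q ∈ A, sqDist P θs fs q ≤ r) (hδ : 0 < δ) (ha : 0 < a)
    (haA : ENNReal.ofReal a ≤ φ.prior p n C A)
    (hρ : Real.exp (3 / 2 * (n * unitTemp L C σ * r) - n * unitTemp L C σ / 2 * ρ) ≤ δ ^ 2 * a) :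
    ENNReal.ofReal (1 - δ) ≤ ∫⁻ D : Fin n → Obs p, φ.gibbs C (invTemp n L C σ) D
      {q | sqDist P θs fs q ≤ ρ} ∂(Measure.pi fun _ : Fin n => P) := by
  have := hM.isProbabilityMeasure
  have hs := unitTemp_pos (L := L) (σ := σ) hC
  have hm1 := measurable_totalExcess (n := n) (θs := θs) hM.measurable_link
  have hm2 := measurable_sqDist (P := P) (θs := θs) hM.measurable_link
  set s := unitTemp L C σ with hs_def
  set μ := φ.prior p n C with hμ
  set κ : ℝ := n * s / 2 * ρ
  have hA0 : μ A ≠ 0 := ((ENNReal.ofReal_pos.2 ha).trans_le haA).ne'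
  have hne : NeZero μ := ⟨fun h0 => hA0 (by simp [h0])⟩
  set U : (Fin n → Obs p) → ℝ≥0∞ := fun D => ∫⁻ q, ENNReal.ofReal (Real.exp
    (n * s / 2 * sqDist P θs fs q - s * totalExcess θs fs D q)) ∂μ with hU
  set V : (Fin n → Obs p) → ℝ≥0∞ := fun D => (μ A ^ 2)⁻¹ * ∫⁻ q in A, ENNReal.ofReal (Real.exp
    (s * totalExcess θs fs D q)) ∂μ with hV
  have hUm : Measurable U := Measurable.lintegral_prod_right' (f := fun r : (Fin n → Obs p) ×
    (Idx p × LinkSpace) => ENNReal.ofReal (Real.exp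
      (n * s / 2 * sqDist P θs fs r.2 - s * totalExcess θs fs r.1 r.2))) (by fun_prop)
  have hVm' : Measurable fun D : Fin n → Obs p => ∫⁻ q in A, ENNReal.ofReal (Real.exp
    (s * totalExcess θs fs D q)) ∂μ := Measurable.lintegral_prod_right' (f := fun r :
      (Fin n → Obs p) × (Idx p × LinkSpace) => ENNReal.ofReal (Real.exp
        (s * totalExcess θs fs r.1 r.2))) (by fun_prop)
  have hVm : Measurable V := hVm'.const_mul _
  have hUle : ∫⁻ D, U D ∂(Measure.pi fun _ : Fin n => P) ≤ 1 :=
    lintegral_exp_neg_totalExcess_le φ hM hN hB hL hC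
  have hVle : ∫⁻ D, V D ∂(Measure.pi fun _ : Fin n => P) ≤
      ENNReal.ofReal (Real.exp (3 / 2 * (n * s * r))) * (ENNReal.ofReal a)⁻¹ := by
    rw [hV, lintegral_const_mul _ hVm']
    calc _ ≤ (μ A ^ 2)⁻¹ * (ENNReal.ofReal (Real.exp (3 / 2 * (n * s * r))) * μ A) := by
          gcongr
          exact setLIntegral_exp_totalExcess_le φ hM hN hB hL hC hA hr
      _ = ENNReal.ofReal (Real.exp (3 / 2 * (n * s * r))) * (μ A)⁻¹ := by
          rw [sq, ENNReal.mul_inv (Or.inl hA0) (Or.inl (measure_ne_top _ _)), mul_left_comm,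
            mul_assoc (μ A)⁻¹, ENNReal.inv_mul_cancel hA0 (measure_ne_top _ _), mul_one]
      _ ≤ _ := by gcongr
  -- A measurable majorant of the bad posterior mass. Each summand has expectation at most `δ/2`;
  -- for the second, this is where `δ²` in `hρ` is needed.
  set F : (Fin n → Obs p) → ℝ≥0∞ := fun D =>
    ENNReal.ofReal (δ / 2) * U D + ENNReal.ofReal (Real.exp (-κ) / (2 * δ)) * V D with hF
  have hFm : Measurable F := (hUm.const_mul _).add (hVm.const_mul _)
  have hFle : ∫⁻ D, F D ∂(Measure.pi fun _ : Fin n => P) ≤ ENNReal.ofReal δ := by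
    rw [hF, lintegral_add_left (hUm.const_mul _), lintegral_const_mul _ hUm,
      lintegral_const_mul _ hVm]
    calc _ ≤ ENNReal.ofReal (δ / 2) * 1 + ENNReal.ofReal (Real.exp (-κ) / (2 * δ)) *
          (ENNReal.ofReal (Real.exp (3 / 2 * (n * s * r))) * (ENNReal.ofReal a)⁻¹) := by gcongr
      _ = ENNReal.ofReal (δ / 2 + Real.exp (-κ) / (2 * δ) *
            (Real.exp (3 / 2 * (n * s * r)) * a⁻¹)) := by
          rw [mul_one, ← ENNReal.ofReal_inv_of_pos ha, ← ENNReal.ofReal_mul (Real.exp_pos _).le,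
            ← ENNReal.ofReal_mul (by positivity), ← ENNReal.ofReal_add (by positivity)
              (by positivity)]
      _ ≤ ENNReal.ofReal δ := by
          refine ENNReal.ofReal_le_ofReal ?_
          have h1 : Real.exp (-κ) / (2 * δ) * (Real.exp (3 / 2 * (n * s * r)) * a⁻¹) =
              Real.exp (3 / 2 * (n * s * r) - κ) / (2 * δ * a) := by
            rw [sub_eq_add_neg, Real.exp_add]; field_simp
          have h2 : Real.exp (3 / 2 * (n * s * r) - κ) / (2 * δ * a) ≤ δ / 2 := by
            rw [div_le_iff₀ (by positivity)]
            refine hρ.trans (le_of_eq ?_)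
            ring
          rw [h1]; linarith
  have hpoint : ∀ D : Fin n → Obs p,
      1 ≤ φ.gibbs C (invTemp n L C σ) D {q | sqDist P θs fs q ≤ ρ} + F D := by
    intro D
    have hint := integrable_exp_neg_totalExcess (C := C) (θs := θs) φ hM.measurable_link hs.le D
    have hmD := measurable_totalExcess_right (θs := θs) hM.measurable_link D
    rw [φ.gibbs_eq_tilted hn θs fs D, ← hμ, ← hs_def]
    set ν := μ.tilted fun q => -(s * totalExcess θs fs D q) with hν
    have hprob : IsProbabilityMeasure ν := isProbabilityMeasure_tilted hint
    have hbad : ν {q | sqDist P θs fs q ≤ ρ}ᶜ ≤ F D := by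
      refine le_half_add_of_le_mul (Real.exp_pos _) hδ prob_le_one ?_
      refine tilted_neg_le μ (h := fun q => s * totalExcess θs fs D q)
        (G := fun q => n * s / 2 * sqDist P θs fs q) (by fun_prop) (by fun_prop) hint hA0
        fun q hq => ?_
      have : ρ < sqDist P θs fs q := not_le.1 hq
      change n * s / 2 * ρ ≤ n * s / 2 * sqDist P θs fs q
      gcongr
    calc (1 : ℝ≥0∞) = ν Set.univ := measure_univ.symm
      _ ≤ ν {q | sqDist P θs fs q ≤ ρ} + ν {q | sqDist P θs fs q ≤ ρ}ᶜ := by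
          rw [← Set.union_compl_self {q | sqDist P θs fs q ≤ ρ}]
          exact measure_union_le _ _
      _ ≤ _ := by gcongr
  have htotal : (1 : ℝ≥0∞) ≤ (∫⁻ D : Fin n → Obs p, φ.gibbs C (invTemp n L C σ) D
      {q | sqDist P θs fs q ≤ ρ} ∂(Measure.pi fun _ : Fin n => P)) + ENNReal.ofReal δ := by
    calc (1 : ℝ≥0∞) = ∫⁻ _ : Fin n → Obs p, 1 ∂(Measure.pi fun _ : Fin n => P) := by simp
      _ ≤ ∫⁻ D : Fin n → Obs p, (φ.gibbs C (invTemp n L C σ) D {q | sqDist P θs fs q ≤ ρ} + F D)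
            ∂(Measure.pi fun _ : Fin n => P) := lintegral_mono hpoint
      _ = _ := lintegral_add_right _ hFm
      _ ≤ _ := by gcongr
  rw [ENNReal.ofReal_sub _ hδ.le, ENNReal.ofReal_one]
  exact tsub_le_iff_right.2 htotal

end Sample

/-! ### The oracle inequality -/

theorem posFace_subset_sphereOn {p : ℕ} (I : Finset (Fin p)) : posFace I ⊆ sphereOn I := by
  rintro θ ⟨h1, h2⟩
  have h3 : ∀ j, θ j = 0 ↔ j ∉ I := fun j => by
    have := h2 j
    split_ifs at this with h
    · exact iff_of_false this.ne' (not_not.2 h)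
    · exact iff_of_true this h
  refine ⟨⟨h1, fun j hj _ => ?_⟩, h3⟩
  have := h2 j
  rwa [if_pos (not_not.1 ((not_congr (h3 j)).1 hj))] at this

theorem sphereOn_nonempty {p : ℕ} {I : Finset (Fin p)} (hI : I.Nonempty) : (sphereOn I).Nonempty := by
  obtain ⟨j, hj⟩ := hI
  exact (nonempty_of_measure_ne_zero (hausdorffMeasure_posFace_ne_zero I j hj)).mono
    (posFace_subset_sphereOn I)

section Oracle

variable {p n M : ℕ} {P : Measure (Obs p)} {θs : Idx p} {fs : ℝ → ℝ} {L C σ ℓ : ℝ}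

theorem abs_linkFun_sub_le (f g : LinkSpace) (t : ℝ) : |linkFun f t - linkFun g t| ≤ ‖f - g‖ :=
  abs_linkFun_le (f - g) t

/-- Moving the link costs its uniform distance `2(C+1)/n`; moving the index costs `2/n` times the
Lipschitz constant `ℓ C` of the central link, which the weights in `coeffSet` control. -/
theorem sqDist_le_of_mem_predictorBall (φ : Dictionary ℓ) (hM : IsSingleIndexModel P θs fs)
    (hB : AssumptionB P fs C) (hℓ : 0 ≤ ℓ) (hn : 1 ≤ n) {θ₀ : Idx p} {β₀ : Fin M → ℝ}
    (hβ : β₀ ∈ coeffSet M C) {q : Idx p × LinkSpace}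
    (hq : q ∈ predictorBall n C θ₀ (φ.comb M β₀)) :
    sqDist P θs fs q ≤ 2 * sqDist P θs fs (θ₀, φ.comb M β₀)
      + 2 * ((2 * (C + 1) + 2 * (ℓ * C)) / n) ^ 2 := by
  have := hM.isProbabilityMeasure
  have hn0 : (0 : ℝ) < n := by exact_mod_cast hn
  set f₀ := φ.comb M β₀
  set b : ℝ := (2 * (C + 1) + 2 * (ℓ * C)) / n with hb
  have hC : 0 ≤ C := (Finset.sum_nonneg fun i _ => by positivity).trans hβ.1
  have hpt : ∀ᵐ z ∂P, gap θs fs q z.1 ^ 2 ≤ 2 * gap θs fs (θ₀, f₀) z.1 ^ 2 + 2 * b ^ 2 := by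
    filter_upwards [hB.1] with z hz
    have h1 : |linkFun f₀ (dot q.1 z.1) - linkFun f₀ (dot θ₀ z.1)| ≤ ℓ * C * (2 * (1 / n)) := by
      refine (φ.abs_linkFun_comb_sub_le hℓ β₀ _ _).trans ?_
      rw [← dot_sub_left]
      gcongr
      · exact hβ.1
      · exact (abs_dot_le _ hz).trans hq.1
    have h2 : |linkFun q.2 (dot q.1 z.1) - linkFun f₀ (dot q.1 z.1)| ≤ 2 * (C + 1) * (1 / n) :=
      (abs_linkFun_sub_le _ _ _).trans hq.2
    have h3 : |gap θs fs (θ₀, f₀) z.1 - gap θs fs q z.1| ≤ b := by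
      have heq : gap θs fs (θ₀, f₀) z.1 - gap θs fs q z.1 =
          (linkFun q.2 (dot q.1 z.1) - linkFun f₀ (dot q.1 z.1)) +
            (linkFun f₀ (dot q.1 z.1) - linkFun f₀ (dot θ₀ z.1)) := by
        simp only [gap]; ring
      rw [heq]
      refine (abs_add_le _ _).trans ((add_le_add h2 h1).trans (le_of_eq ?_))
      rw [hb]; ring
    have h4 := sq_le_sq' (abs_le.1 h3).1 (abs_le.1 h3).2
    -- Uses the identity `2a² + 2(a - c)² - c² = (2a - c)²`.
    nlinarith [sq_nonneg (2 * gap θs fs (θ₀, f₀) z.1 - gap θs fs q z.1)]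
  have hi := integrable_gap_sq hM hB (θ₀, f₀)
  calc sqDist P θs fs q ≤ ∫ z, (2 * gap θs fs (θ₀, f₀) z.1 ^ 2 + 2 * b ^ 2) ∂P :=
        integral_mono_ae (integrable_gap_sq hM hB q)
          ((hi.const_mul 2).add (integrable_const _)) hpt
    _ = _ := by
        rw [integral_add (hi.const_mul 2) (integrable_const _), integral_const_mul]
        simp [sqDist]

theorem predRisk_eq_add_sqDist (hM : IsSingleIndexModel P θs fs) (hN : AssumptionN P θs fs L σ)
    (hB : AssumptionB P fs C) (q : Idx p × LinkSpace) :
    predRisk P q.1 (linkFun q.2) = predRisk P θs fs + sqDist P θs fs q := by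
  have h := predRisk_sub_predRisk hM hN hB q
  rw [sqDist, ← h]; ring

/-- The model is not closed, so a minimizer may fail to exist. A slack `η` of order `log(2/δ)/n` is
absorbed in the final bound. -/
theorem exists_near_minimizer (φ : Dictionary ℓ) (hM : IsSingleIndexModel P θs fs)
    (hN : AssumptionN P θs fs L σ) (hB : AssumptionB P fs C) (hC : 0 < C) {I : Finset (Fin p)}
    (hI : I.Nonempty) (hM1 : 1 ≤ M) {η : ℝ} (hη : 0 < η) :
    0 ≤ bestRisk P φ C I M - predRisk P θs fs ∧
    ∃ θ₀ ∈ sphereOn I, ∃ β₀ ∈ coeffSet M C,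
      sqDist P θs fs (θ₀, φ.comb M β₀) ≤ bestRisk P φ C I M - predRisk P θs fs + η := by
  have hne : ((fun q : Idx p × LinkSpace => predRisk P q.1 (linkFun q.2)) ''
      (sphereOn I ×ˢ φ.linkSet M C)).Nonempty := by
    obtain ⟨β, h1, h2⟩ := exists_mem_coeffSet hM1 hC
    have hβ : β ∈ coeffSet M C := ⟨h1.le, h2⟩
    have hlink : (φ.linkSet M C).Nonempty := ⟨_, Set.mem_image_of_mem (φ.comb M) hβ⟩
    exact ((sphereOn_nonempty hI).prod hlink).image _
  refine ⟨sub_nonneg.2 (le_csInf hne ?_), ?_⟩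
  · rintro _ ⟨q, _, rfl⟩
    change predRisk P θs fs ≤ predRisk P q.1 (linkFun q.2)
    rw [predRisk_eq_add_sqDist hM hN hB q]
    linarith [sqDist_nonneg (P := P) (θs := θs) (fs := fs) q]
  · obtain ⟨_, ⟨⟨θ₀, f₀⟩, ⟨hθ, β₀, hβ, hf⟩, rfl⟩, hlt⟩ :=
      exists_lt_of_csInf_lt hne (lt_add_of_pos_right _ hη)
    refine ⟨θ₀, hθ, β₀, hβ, ?_⟩
    have h := predRisk_eq_add_sqDist hM hN hB (θ₀, f₀)
    have hf' : φ.comb M β₀ = f₀ := hf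
    rw [hf']
    simp only [bestRisk] at hlt h ⊢
    linarith

/-- If `x ≥ 2`, then `log x` absorbs `log c`. Otherwise `log x` may vanish, but `k = 1`, so a single
`log c` remains, paid for by `5 log 2`. -/
theorem mul_log_le_of_two_le_or_eq_one {k : ℕ} {x c : ℝ}
    (h : 2 ≤ x ∨ (1 ≤ x ∧ k = 1)) (hc : c ≤ 32) (hc0 : 1 ≤ c) :
    (k : ℝ) * Real.log (c * x) ≤ 6 * (k * Real.log x) + 5 * Real.log 2 := by
  have hx : 1 ≤ x := by rcases h with h | h <;> linarith
  have hlogc : Real.log c ≤ 5 * Real.log 2 := by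
    have : Real.log c ≤ Real.log (2 ^ 5) := Real.log_le_log (by linarith) (by norm_num; exact hc)
    rwa [Real.log_pow] at this
  have hlogx := Real.log_nonneg hx
  have hl2 := Real.log_pos one_lt_two
  rw [Real.log_mul (by linarith) (by linarith)]
  rcases h with h | ⟨_, rfl⟩
  · have h2x := Real.log_le_log two_pos h
    have : (0 : ℝ) ≤ k := Nat.cast_nonneg k
    nlinarith [mul_le_mul_of_nonneg_left (show Real.log c ≤ 5 * Real.log x by linarith) this]
  · push_cast; linarith

/-- The arithmetic that turns the prior mass and the radius of a small ball into the oracle bound. -/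
theorem exp_oracle_le {k : ℕ} {s e b r δ : ℝ} (hs : 0 < s) (hC : 1 ≤ C) (hn : 1 ≤ n) (hMn : M ≤ n)
    (hM1 : 1 ≤ M) (hk : 1 ≤ k) (hkp : k ≤ p) (hδ : 0 < δ) (hδ1 : δ < 1) (he : 0 ≤ e)
    (hr : r ≤ 2 * (e + Real.log (2 / δ) / n) + 2 * (b / n) ^ 2) :
    Real.exp (3 / 2 * (n * s * r) - n * s / 2 * ((24 / s + 6 + 12 * b ^ 2) * (e +
      ((M : ℝ) * Real.log (C * n) + (k : ℝ) * Real.log (p * n) + Real.log (2 / δ)) / n))) ≤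
      δ ^ 2 * ((1 / (20 * (p * n))) ^ k * (1 / (10 * n)) ^ M) := by
  have hn1 : (1 : ℝ) ≤ n := by exact_mod_cast hn
  have hn0 : (0 : ℝ) < n := by linarith
  have hp1 : (1 : ℝ) ≤ p := by exact_mod_cast hk.trans hkp
  have hl2 : 1 / 2 ≤ Real.log 2 := by linarith [Real.log_two_gt_d9]
  have hlogδ : Real.log (2 / δ) = Real.log 2 - Real.log δ := Real.log_div two_ne_zero hδ.ne'
  have hlogδ0 : Real.log δ ≤ 0 := Real.log_nonpos hδ.le hδ1.le
  have hpn : 2 ≤ (p : ℝ) * n ∨ (1 ≤ (p : ℝ) * n ∧ k = 1) := by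
    rcases Nat.lt_or_ge (p * n) 2 with h | h
    · refine Or.inr ⟨one_le_mul_of_one_le_of_one_le hp1 hn1, le_antisymm ?_ hk⟩
      have : p * 1 ≤ p * n := Nat.mul_le_mul_left p hn
      omega
    · exact Or.inl (by exact_mod_cast h)
  have hCn : 2 ≤ C * n ∨ (1 ≤ C * n ∧ M = 1) := by
    rcases Nat.lt_or_ge n 2 with h | h
    · exact Or.inr ⟨one_le_mul_of_one_le_of_one_le hC hn1, by omega⟩
    · have : (2 : ℝ) ≤ n := by exact_mod_cast h
      exact Or.inl (by nlinarith)
  have hA := mul_log_le_of_two_le_or_eq_one hpn (c := 20) (by norm_num) (by norm_num)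
  have hB := mul_log_le_of_two_le_or_eq_one hCn (c := 10) (by norm_num) (by norm_num)
  have hB' : (M : ℝ) * Real.log (10 * n) ≤ M * Real.log (10 * (C * n)) := by
    gcongr
    nlinarith
  have h1 : 0 ≤ (M : ℝ) * Real.log (C * n) :=
    mul_nonneg (Nat.cast_nonneg _) (Real.log_nonneg (one_le_mul_of_one_le_of_one_le hC hn1))
  have h2 : 0 ≤ (k : ℝ) * Real.log (p * n) :=
    mul_nonneg (Nat.cast_nonneg _) (Real.log_nonneg (one_le_mul_of_one_le_of_one_le hp1 hn1))
  have hrhs : δ ^ 2 * ((1 / (20 * (p * n))) ^ k * (1 / (10 * n)) ^ M) =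
      Real.exp (2 * Real.log δ - k * Real.log (20 * (p * n)) - M * Real.log (10 * n)) := by
    have hδ2 : Real.exp (2 * Real.log δ) = δ ^ 2 := by
      rw [two_mul, Real.exp_add, Real.exp_log hδ, sq]
    rw [Real.exp_sub, Real.exp_sub, Real.exp_nat_mul, Real.exp_nat_mul,
      Real.exp_log (by positivity), Real.exp_log (by positivity), hδ2, div_pow, div_pow, one_pow,
      one_pow]
    field_simp
  rw [hrhs]
  refine Real.exp_le_exp.2 ?_
  set Λ := Real.log (2 / δ)
  set Q := (M : ℝ) * Real.log (C * n) + (k : ℝ) * Real.log (p * n) + Λ with hQ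
  have hΛQ : Λ ≤ Q := by linarith
  have hbias : 3 / 2 * (n * s * r) ≤ 3 * (n * s * e) + 3 * s * Q + 6 * b ^ 2 * s * Q := by
    -- Here `Q ≥ log(2/δ) ≥ log 2 ≥ 1/2`, so the discretization error is absorbed in the complexity
    -- term.
    have hb : b ^ 2 / n ≤ 2 * b ^ 2 * Q := by
      calc b ^ 2 / n ≤ b ^ 2 := div_le_self (sq_nonneg b) hn1
        _ ≤ 2 * b ^ 2 * Q := by nlinarith [sq_nonneg b]
    calc 3 / 2 * (n * s * r) ≤ 3 / 2 * (n * s * (2 * (e + Λ / n) + 2 * (b / n) ^ 2)) := by gcongr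
      _ = 3 * (n * s * e) + 3 * s * Λ + 3 * s * (b ^ 2 / n) := by field_simp
      _ ≤ 3 * (n * s * e) + 3 * s * Q + 3 * s * (2 * b ^ 2 * Q) := by gcongr
      _ = _ := by ring
  -- The summand `24/s` gives `12 Q`, which pays for the prior mass and `δ²`; `6` pays for the bias
  -- and the slack; `12 b²` pays for the radius of the ball.
  have hmain : n * s / 2 * ((24 / s + 6 + 12 * b ^ 2) * (e + Q / n)) =
      12 * n * e + 3 * (n * s * e) + 6 * b ^ 2 * (n * s * e) +
        12 * Q + 3 * s * Q + 6 * b ^ 2 * s * Q := by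
    field_simp; ring
  have hpos1 : 0 ≤ 12 * n * e := by positivity
  have hpos2 : 0 ≤ 6 * b ^ 2 * (n * s * e) := by positivity
  rw [hmain]
  linarith

end Oracle

theorem finite_modelIndex (p n : ℕ) : Finite (ModelIndex p n) := by
  refine Finite.of_injective (fun m : ModelIndex p n =>
    ((m.1.1, ⟨m.1.2, Nat.lt_succ_of_le m.2.2.2⟩) : Finset (Fin p) × Fin (n + 1))) ?_
  rintro ⟨⟨I, M⟩, h⟩ ⟨⟨J, N⟩, h'⟩ heq
  simpa using heq

end SingleIndex

open SingleIndex
theorem theorem2p1 (L C σ ℓ : ℝ) (hL : 0 < L) (hC : 1 ≤ C) (hσ : 0 < σ) (hℓ : 0 < ℓ) :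
    ∃ Ξ : ℝ, 0 < Ξ ∧
      ∀ (p n : ℕ), 1 ≤ n →
      ∀ (φ : Dictionary ℓ) (P : Measure (Obs p)) (θs : Idx p) (fs : ℝ → ℝ),
        IsSingleIndexModel P θs fs → AssumptionN P θs fs L σ → AssumptionB P fs C →
      ∀ δ : ℝ, 0 < δ → δ < 1 →
        ENNReal.ofReal (1 - δ) ≤
          ∫⁻ D : Fin n → Obs p,
            φ.gibbs C (invTemp n L C σ) D
              {q : Idx p × LinkSpace |
                predRisk P q.1 (linkFun q.2) - predRisk P θs fs ≤
                  Ξ * ⨅ m : ModelIndex p n,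
                    (bestRisk P φ C m.1.1 m.1.2 - predRisk P θs fs +
                      ((m.1.2 : ℝ) * Real.log (C * n) + (m.1.1.card : ℝ) * Real.log (p * n) +
                        Real.log (2 / δ)) / n)}
            ∂(Measure.pi fun _ : Fin n => P) := by
  have hC0 : 0 < C := by linarith
  have hs : 0 < unitTemp L C σ := unitTemp_pos hC0.le
  refine ⟨24 / unitTemp L C σ + 6 + 12 * (2 * (C + 1) + 2 * (ℓ * C)) ^ 2, by positivity, ?_⟩
  intro p n hn φ P θs fs hM hN hB δ hδ hδ1
  have hn0 : (0 : ℝ) < n := by exact_mod_cast hn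
  have hp : 0 < p := by
    rcases Nat.eq_zero_or_pos p with rfl | h
    · exact absurd hM.index_mem.1 (by simp)
    · exact h
  have hfin := finite_modelIndex p n
  have hne : Nonempty (ModelIndex p n) := ⟨⟨({⟨0, hp⟩}, 1), Finset.singleton_nonempty _, le_rfl, hn⟩⟩
  -- The infimum runs over finitely many models, so it is attained at a deterministic one;
  -- concentration is needed for that model only, without a union bound.
  obtain ⟨m, hm⟩ := exists_eq_ciInf_of_finite (f := fun m : ModelIndex p n =>
    (bestRisk P φ C m.1.1 m.1.2 - predRisk P θs fs +
      ((m.1.2 : ℝ) * Real.log (C * n) + (m.1.1.card : ℝ) * Real.log (p * n) +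
        Real.log (2 / δ)) / n))
  rw [← hm]
  obtain ⟨⟨I, M⟩, hI, hM1, hMn⟩ := m
  have hΛ : 0 < Real.log (2 / δ) := Real.log_pos (by rw [lt_div_iff₀ hδ]; linarith)
  obtain ⟨he, θ₀, hθ, β₀, hβ, hnear⟩ :=
    exists_near_minimizer φ hM hN hB hC0 hI hM1 (div_pos hΛ hn0)
  have hp0 : (0 : ℝ) < p := by exact_mod_cast hp
  have hcard : I.card ≤ p := by simpa using Finset.card_le_univ I
  simp only [predRisk_sub_predRisk hM hN hB]
  refine φ.gibbs_concentration hM hN hB hL.le hC0.le hn (measurableSet_predictorBall n C θ₀ _)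
    (fun q hq => sqDist_le_of_mem_predictorBall φ hM hB hℓ.le hn hβ hq) hδ (by positivity)
    (φ.prior_predictorBall_ge hC0.le hM1 hMn hI hθ hβ)
    (exp_oracle_le hs hC hn hMn hM1 hI.card_pos hcard hδ hδ1 he ?_)
  gcongr
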